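/- **Theorem (GSWAP Soundness).** Let $n=\log_2 D$ be the security parameter and let $(\mathrm{qPUF}_n)_n$ be a family of unitary qPUFs, $\mathrm{qPUF}_n$ being a random unitary $U$ on the $n$-qubit space $\mathcal H^D$. A QPT adversary is a family of quantum circuits with polynomially many qubits, gates and queries to $U$: in a learning phase she may query $U$ adaptively; afterwards she has no access to $U$ and answers challenges. Write $F(\rho,|\psi\rangle)=\sqrt{\langle\psi|\rho|\psi\rangle}$. Assume that $(\mathrm{qPUF}_n)_n$ is *selectively unforgeable*: for every QPT adversary, whose answer to a single Haar-random challenge $|\phi\rangle\in\mathcal H^D$ is $\sigma$, and for every $\delta(n)\ge 1/\mathrm{poly}(n)$, $$\Pr\big[F(\sigma,U|\phi\rangle)^2\ge\delta(n)\big]\le \mathrm{negl}(n),$$ the probability being over $U$ and $|\phi\rangle$. In the protocol hrv-id-gswap, Alice prepares $K=K(n)\le\mathrm{poly}(n)$ independent Haar-random challenges and stores $M=M(n)$ copies of the response of $U$ to each of them. She then uses $N=N(n)\le K$ distinct ones, $|\phi^c_1\rangle,\dots,|\phi^c_N\rangle$, chosen uniformly at random; they are sent one per round, and the prover returns one $n$-qubit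 register per round. With $|\phi^r_i\rangle=U|\phi^c_i\rangle$, the $i$-th returned register is compared with $|\phi^r_i\rangle^{\otimes M}$ by one generalised SWAP test: an ancilla in the state $(M+1)^{-1/2}\sum_{k=0}^M|k\rangle$ controls a cyclic shift by $k$ of the $M+1$ registers, and the test accepts if the ancilla is then found in its initial state. Alice accepts if all $N$ tests accept. Then for every QPT adversary Eve, who may entangle her answers across rounds and answer adaptively: 1. For every $U$ and all challenges, the probability that Alice accepts equals $$\epsilon=\prod_{i=1}^N\Big(\frac1{M+1}+\frac{M}{M+1}F_i^2\Big),\qquad F_i=F(\rho_i,|\phi^r_i\rangle),$$ where $\rho_i$ is the state of the register entering the $i$-th test given that the tests of the earlier rounds accepted. If Eve's returned registers are in a product state, the same holds with $\rho_i$ the reduced state of the $i$-th returned register. 2. There is a negligible function $\nu$ such that, on average over the device, the challenges and their selection, $$\Pr[\text{Ver accept}_{\text{Eve}}]\le\frac{1}{(M+1)^N}+\nu(n)\quad\text{for all } n.$$ In particular $\Pr[\text{Ver accept}_{\text{Eve}}]=O\big((M+1)^{-N}\big)$ whenever $(M+1)^N$ is polynomially bounded in $n$ (for instance for constant $M$ and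 $N$), and $\Pr[\text{Ver accept}_{\text{Eve}}]$ is negligible whenever $(M+1)^{-N}$ is. -/

import Mathlib

open MeasureTheory Filter Asymptotics

noncomputable section

/-! ### Qubits, local operators, reduced states -/

/-- Amplitudes, in the computational basis, of a (pure, possibly unnormalised) state of a set `W` of
qubits ("wires"). -/
abbrev QState (W : Type) : Type := (W → Bool) → ℂ

/-- The all-zero basis state. -/
def zeroState (W : Type) [Fintype W] [DecidableEq W] : QState W :=
  fun x => if x = fun _ => false then 1 else 0

/-- Apply the operator `V` to the wires `e a`, `a : A`, and the identity to all other wires.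
`Function.extend e y x` is the labelling that is `y` on the wires in the range of `e` and `x`
elsewhere. -/
def applyOn {A W : Type} [Fintype A] [DecidableEq A] (e : A ↪ W)
    (V : Matrix (A → Bool) (A → Bool) ℂ) (ψ : QState W) : QState W :=
  fun x => ∑ y : A → Bool, V (fun a => x (e a)) y * ψ (Function.extend e y x)

/-- The squared norm `⟨ψ|ψ⟩`. -/
def normSq {W : Type} [Fintype W] [DecidableEq W] (ψ : QState W) : ℝ := ∑ x, ‖ψ x‖ ^ 2

/-- The density matrix of the wires `e a`, `a : A`: the partial trace of `|ψ⟩⟨ψ|` over all other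
wires. -/
def partialTrace {A W : Type} [Fintype A] [Fintype W] [DecidableEq A] [DecidableEq W] (e : A ↪ W)
    (ψ : QState W) : Matrix (A → Bool) (A → Bool) ℂ :=
  fun y y' => ∑ x : W → Bool,
    if (fun a => x (e a)) = y then ψ x * star (ψ (Function.extend e y' x)) else 0

/-- The fidelity `F(ρ, |ψ⟩) = √⟨ψ|ρ|ψ⟩` of a density matrix with a pure state. -/
def fidelity {A : Type} [Fintype A] [DecidableEq A] (ρ : Matrix (A → Bool) (A → Bool) ℂ)
    (ψ : QState A) : ℝ :=
  √(star ψ ⬝ᵥ ρ.mulVec ψ).re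

/-! ### Asymptotics in the security parameter -/

/-- Negligible functions of the security parameter. -/
def Negligible (f : ℕ → ℝ) : Prop := SuperpolynomialDecay atTop (fun n : ℕ => (n : ℝ)) f

/-- Functions that are eventually at least an inverse polynomial. -/
def Noticeable (f : ℕ → ℝ) : Prop := ∃ k : ℕ, ∀ᶠ n : ℕ in atTop, ((n : ℝ) ^ k)⁻¹ ≤ f n

/-- Functions bounded by a polynomial. -/
def PolyBounded (f : ℕ → ℕ) : Prop := ∃ p : Polynomial ℕ, ∀ n, f n ≤ p.eval n

/-! ### Unitary qPUFs and random challenges -/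

/-- The unitaries on `n` qubits, that is, on a Hilbert space of dimension `D = 2 ^ n`. -/
abbrev QUnitary (n : ℕ) : Type := Matrix.unitaryGroup (Fin n → Bool) ℂ

instance (n : ℕ) : MeasurableSpace (QUnitary n) := borel _

instance (n : ℕ) : BorelSpace (QUnitary n) := ⟨rfl⟩

/-- Unit vectors of the `n`-qubit Hilbert space. -/
abbrev UnitState (n : ℕ) : Type := Metric.sphere (0 : EuclideanSpace ℂ (Fin n → Bool)) 1

/-- The amplitudes of a unit vector. -/
def UnitState.amp {n : ℕ} (c : UnitState n) : QState (Fin n) := fun x => c.1 x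

/-- The Haar (uniform) probability distribution on the unit vectors: the normalised surface measure
of the sphere. -/
def haarState (n : ℕ) : Measure (UnitState n) :=
  ((volume : Measure (EuclideanSpace ℂ (Fin n → Bool))).toSphere Set.univ)⁻¹ •
    (volume : Measure (EuclideanSpace ℂ (Fin n → Bool))).toSphere

instance (n : ℕ) : IsProbabilityMeasure (haarState n) where
  measure_univ := by
    have h0 : (volume : Measure (EuclideanSpace ℂ (Fin n → Bool))).toSphere Set.univ ≠ 0 := by
      rw [Measure.toSphere_apply_univ]
      refine mul_ne_zero ?_ (Metric.measure_ball_pos _ _ one_pos).ne'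
      exact_mod_cast (Module.finrank_pos (R := ℝ) (M := EuclideanSpace ℂ (Fin n → Bool))).ne'
    simp only [haarState, Measure.smul_apply, smul_eq_mul]
    exact ENNReal.inv_mul_cancel h0 (measure_ne_top _ _)

/-- The response of the device to a challenge. -/
def response {n : ℕ} (U : QUnitary n) (c : UnitState n) : QState (Fin n) := U.1.mulVec c.amp

/-! ### Quantum circuits with queries to the device -/

/-- A gate: an arbitrary unitary on at most two of the wires. -/
structure LocalGate (W : Type) where
  arity : ℕ
  arity_le : arity ≤ 2
  wires : Fin arity ↪ W
  op : Matrix.unitaryGroup (Fin arity → Bool) ℂ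

def LocalGate.apply {W : Type} (g : LocalGate W) (ψ : QState W) : QState W :=
  applyOn g.wires g.op.1 ψ

/-- The same gate on relabelled wires. -/
def LocalGate.relabel {W W' : Type} (f : W ↪ W') (g : LocalGate W) : LocalGate W' :=
  { arity := g.arity, arity_le := g.arity_le, wires := g.wires.trans f, op := g.op }

/-- A step of an algorithm with access to an `n`-qubit device: a gate, or one query. -/
inductive OracleGate (n : ℕ) (W : Type) where
  | gate (g : LocalGate W)
  | query (e : Fin n ↪ W)

def OracleGate.apply {n : ℕ} {W : Type} (U : QUnitary n) : OracleGate n W → QState W → QState W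
  | .gate g, ψ => g.apply ψ
  | .query e, ψ => applyOn e U.1 ψ

/-- A quantum adversary against an `n`-qubit device, who is challenged in `N` rounds. She owns
`work` qubits, initially zero. In the learning phase she runs `learn`, which may query the device
(adaptively, and on states of her choice). Then, without access to the device, she receives in
round `i` the `i`-th challenge in an `n`-qubit register, runs `answer i` on this register and on
her own qubits, and hands the register back. (Measurements can be deferred, and are discarded
qubits here.) -/
structure Adversary (n N : ℕ) where
  work : ℕ
  learn : List (OracleGate n (Fin work))
  answer : Fin N → List (LocalGate (Fin work ⊕ Fin n))

namespace Adversary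

variable {n N : ℕ}

/-- Number of qubits plus number of gates and queries. -/
def size (A : Adversary n N) : ℕ := A.work + A.learn.length + ∑ i, (A.answer i).length

/-- The adversary's own qubits, and the register of each round. -/
abbrev Wires (A : Adversary n N) : Type := Fin A.work ⊕ (Fin N × Fin n)

/-- The register of round `i`. -/
def register (A : Adversary n N) (i : Fin N) : Fin n ↪ A.Wires :=
  (Function.Embedding.sectR i (Fin n)).trans Function.Embedding.inr

/-- The wires that the adversary holds in round `i`. -/
def roundWires (A : Adversary n N) (i : Fin N) : Fin A.work ⊕ Fin n ↪ A.Wires :=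
  (Function.Embedding.refl (Fin A.work)).sumMap (Function.Embedding.sectR i (Fin n))

/-- The adversary's state after the learning phase. -/
def learned (A : Adversary n N) (U : QUnitary n) : QState (Fin A.work) :=
  A.learn.foldl (fun ψ g => g.apply U ψ) (zeroState (Fin A.work))

/-- The adversary's state after the learning phase, together with all the challenges. -/
def initial (A : Adversary n N) (U : QUnitary n) (c : Fin N → UnitState n) : QState A.Wires :=
  fun x => A.learned U (fun a => x (Sum.inl a)) * ∏ i, (c i).amp (fun b => x (A.register i b))

/-- The joint state of the adversary's qubits and of all returned registers after all rounds. -/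
def final (A : Adversary n N) (U : QUnitary n) (c : Fin N → UnitState n) : QState A.Wires :=
  (List.finRange N).foldl
    (fun ψ i => (A.answer i).foldl (fun φ g => (g.relabel (A.roundWires i)).apply φ) ψ)
    (A.initial U c)

/-- The density matrix of the register returned in round `i`. -/
def returned (A : Adversary n N) (U : QUnitary n) (c : Fin N → UnitState n) (i : Fin N) :
    Matrix (Fin n → Bool) (Fin n → Bool) ℂ :=
  partialTrace (A.register i) (A.final U c)

/-- The joint density matrix of all returned registers. -/
def jointReturned (A : Adversary n N) (U : QUnitary n) (c : Fin N → UnitState n) :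
    Matrix (Fin N × Fin n → Bool) (Fin N × Fin n → Bool) ℂ :=
  partialTrace (Function.Embedding.inr : Fin N × Fin n ↪ A.Wires) (A.final U c)

/-- The returned registers are in a product state (no correlation between the rounds). -/
def IsProduct (A : Adversary n N) (U : QUnitary n) (c : Fin N → UnitState n) : Prop :=
  ∀ y y', A.jointReturned U c y y' =
    ∏ i, A.returned U c i (fun b => y (i, b)) (fun b => y' (i, b))

end Adversary

/-- Quantum polynomial time: polynomially many qubits, gates and queries in the security
parameter `n = log D`. -/
def QPT {N : ℕ → ℕ} (A : ∀ n, Adversary n (N n)) : Prop := PolyBounded fun n => (A n).size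

/-- Selective unforgeability of a family of unitary devices, the `n`-th of which is drawn from the
distribution `qPUF n`: for a Haar-random challenge, a QPT adversary returns a state of non-negligible
squared fidelity with the device's response with negligible probability only. -/
def SelectivelyUnforgeable (qPUF : ∀ n, Measure (QUnitary n)) : Prop :=
  ∀ A : ∀ n, Adversary n 1, QPT A → ∀ δ : ℕ → ℝ, Noticeable δ →
    Negligible fun n => ((qPUF n).prod (haarState n)).real
      {p | δ n ≤ fidelity ((A n).returned p.1 (fun _ => p.2) 0) (response p.1 p.2) ^ 2}

/-! ### Verification with the generalised SWAP test -/

/-- The wires in the verification phase: those of the adversary, and for each round `M + 1`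
registers: number `0` is the returned one, the others hold Alice's copies of the response. -/
abbrev VerWires (w n N M : ℕ) : Type := Fin w ⊕ (Fin N × Fin (M + 1) × Fin n)

/-- Register `s` of round `i`. -/
def verRegister (w : ℕ) {n N M : ℕ} (i : Fin N) (s : Fin (M + 1)) : Fin n ↪ VerWires w n N M :=
  ((Function.Embedding.sectR s (Fin n)).trans
    (Function.Embedding.sectR i (Fin (M + 1) × Fin n))).trans Function.Embedding.inr

/-- The cyclic shift by `k` of the `M + 1` registers of round `i`. -/
def shiftWires {w n N M : ℕ} (i : Fin N) (k : Fin (M + 1)) : VerWires w n N M → VerWires w n N M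
  | Sum.inl a => Sum.inl a
  | Sum.inr (j, s, b) => Sum.inr (j, if j = i then s + k else s, b)

/-- The generalised SWAP test on the `M + 1` registers of round `i`. An ancilla is prepared in
`|+⟩ = (M + 1)^(-1/2) ∑ k, |k⟩`, `0 ≤ k ≤ M`; controlled on `k`, the registers are shifted
cyclically by `k`; then the ancilla is rotated back and measured, and the test accepts if it is
found in its initial state. This is the unnormalised state after acceptance (the component of the
ancilla along `|+⟩`); its squared norm is the probability of acceptance. -/
def gswap {w n N M : ℕ} (i : Fin N) (Φ : QState (VerWires w n N M)) : QState (VerWires w n N M) :=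
  fun x => ∑ k : Fin (M + 1),
    (1 / (√((M : ℝ) + 1) : ℂ)) * ((1 / (√((M : ℝ) + 1) : ℂ)) * Φ (fun v => x (shiftWires i k v)))

namespace Adversary

variable {n N : ℕ}

/-- The state before verification: the final state of the attack, and `M` copies of the correct
response to each challenge. -/
def verInitial (A : Adversary n N) (M : ℕ) (U : QUnitary n) (c : Fin N → UnitState n) :
    QState (VerWires A.work n N M) :=
  fun x =>
    A.final U c (fun v => x (match v with
      | Sum.inl a => Sum.inl a
      | Sum.inr (i, b) => verRegister A.work i 0 b)) *
    ∏ i, ∏ m : Fin M, response U (c i) (fun b => x (verRegister A.work i m.succ b))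

/-- The (unnormalised) state after the tests of the first `t` rounds have all accepted. -/
def passed (A : Adversary n N) (M : ℕ) (U : QUnitary n) (c : Fin N → UnitState n) (t : ℕ) :
    QState (VerWires A.work n N M) :=
  ((List.finRange N).take t).foldl (fun Φ i => gswap i Φ) (A.verInitial M U c)

/-- The probability that all `N` tests accept, for the device `U` and the challenges `c`. -/
def acceptProb (A : Adversary n N) (M : ℕ) (U : QUnitary n) (c : Fin N → UnitState n) : ℝ :=
  normSq (A.passed M U c N)

/-- The state of the returned register that enters the test of round `i`, given that the tests of
the earlier rounds have accepted. -/
def tested (A : Adversary n N) (M : ℕ) (U : QUnitary n) (c : Fin N → UnitState n) (i : Fin N) :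
    Matrix (Fin n → Bool) (Fin n → Bool) ℂ :=
  (((normSq (A.passed M U c i))⁻¹ : ℝ) : ℂ) •
    partialTrace (verRegister A.work i 0) (A.passed M U c i)

/-- The probability that Alice accepts the adversary in the protocol: the device is drawn from
`μ`, Alice draws `K` independent Haar-random challenges, and uses `N` of them, a uniformly random
selection without repetition. -/
def accept (A : Adversary n N) (K M : ℕ) (μ : Measure (QUnitary n)) : ℝ :=
  ∫ U, ∫ c : Fin K → UnitState n,
    (Fintype.card (Fin N ↪ Fin K) : ℝ)⁻¹ * ∑ s : Fin N ↪ Fin K,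
      A.acceptProb M U (fun i => c (s i))
    ∂(Measure.pi fun _ => haarState n) ∂μ

end Adversary

end

/-!
Fix the device and the challenges. In round `i` the returned register meets `M` copies of the
correct response `r i`. The generalised SWAP test projects on the cyclically invariant vectors, and
between states of the form `|y⟩ ⊗ r i ⊗ ⋯ ⊗ r i` every nontrivial shift contributes the overlap of
`|y⟩` with `r i` twice (`sum_shift_roundState`). So, as far as norms are concerned, a test acts on
the returned register alone, as the effect `1 / (M + 1) + M / (M + 1) • |r i⟩⟨r i|`
(`testEffect`, `sum_testedState`). Expanding the final state of the attack in product states, the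
norm after any number of accepted tests, and the overlaps with the responses, become values of one
form `tensorForm` that is linear and monotone in each of the effects (`Adversary.normSq_passed`,
`Adversary.overlap_passed`). Linearity gives the exact formula with conditional states; it also
shows that the conditioning event never has probability zero. If the returned registers are in a
product state, the form factorises. Monotonicity bounds the probability of acceptance by
`(M + 1) ^ (-N)` plus the sum over the rounds of the squared fidelities of the returned registers
with the responses (`Adversary.acceptProb_le`).

It remains to see that the expected squared fidelity in a given round `i` is negligible, for which
the attack is turned into one on a single challenge. The adversary in that attack cannot prepare
Haar-random challenges for the other rounds, but she need not: the final state is linear in each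
challenge, the fidelity is therefore quadratic in it, and distinct amplitudes of a Haar-random state
are uncorrelated (`integral_amp_mul_star_eq_zero`). Hence a random basis state in the place of the
challenge of another round gives the same expected fidelity, and some fixed basis state gives at
least as much (`Adversary.exists_integral_score_le_insert`). Preparing these basis states with
one-qubit gates in the learning phase and running all the rounds on the single challenge
(`Adversary.reduce`) costs polynomially many further qubits and gates. For this adversary the
expected squared fidelity is at most any inverse polynomial plus a negligible probability of
exceeding it (`SelectivelyUnforgeable.negligible_score`).
-/

noncomputable section

/-! ### Haar-random challenges -/

/-- The computational basis state `|z⟩`, as a challenge. -/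
def basisState {n : ℕ} (z : Fin n → Bool) : UnitState n :=
  ⟨EuclideanSpace.single z 1, by simp⟩

theorem amp_basisState {n : ℕ} (z x : Fin n → Bool) :
    (basisState z).amp x = if x = z then 1 else 0 := by
  simp [basisState, UnitState.amp]

theorem continuous_amp {n : ℕ} (x : Fin n → Bool) : Continuous fun c : UnitState n => c.amp x := by
  unfold UnitState.amp
  fun_prop

theorem sum_norm_amp_sq {n : ℕ} (c : UnitState n) : ∑ x, ‖c.amp x‖ ^ 2 = 1 := by
  have h : ‖c.1‖ = 1 := by simp
  have := EuclideanSpace.norm_sq_eq c.1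
  rw [h] at this
  simpa [UnitState.amp] using this.symm

theorem norm_amp_le_one {n : ℕ} (c : UnitState n) (x : Fin n → Bool) : ‖c.amp x‖ ≤ 1 := by
  have h := Finset.single_le_sum (f := fun x => ‖c.amp x‖ ^ 2) (fun _ _ => by positivity)
    (Finset.mem_univ x)
  rw [sum_norm_amp_sq] at h
  exact (sq_le_one_iff₀ (norm_nonneg _)).1 h

/-- A linear isometry of the Hilbert space, restricted to the unit vectors. -/
def sphereMap {n : ℕ} (T : EuclideanSpace ℂ (Fin n → Bool) ≃ₗᵢ[ℝ] EuclideanSpace ℂ (Fin n → Bool))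
    (c : UnitState n) : UnitState n :=
  ⟨T c.1, by simp⟩

theorem measurePreserving_sphereMap {n : ℕ}
    (T : EuclideanSpace ℂ (Fin n → Bool) ≃ₗᵢ[ℝ] EuclideanSpace ℂ (Fin n → Bool)) :
    MeasurePreserving (sphereMap T) (haarState n) (haarState n) := by
  have hm : Measurable (sphereMap T) := by
    have : Continuous (sphereMap T) := by unfold sphereMap; fun_prop
    exact this.measurable
  refine ⟨hm, ?_⟩
  ext s hs
  rw [Measure.map_apply hm hs]
  simp only [haarState, Measure.smul_apply]
  congr 1
  rw [Measure.toSphere_apply' _ hs, Measure.toSphere_apply' _ (hm hs)]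
  congr 1
  have hT : MeasurePreserving T volume volume := T.measurePreserving
  symm
  rw [← hT.measure_preimage_equiv (f := T.toMeasurableEquiv)]
  congr 1
  ext v
  simp only [Set.mem_smul, Set.mem_image, Set.mem_preimage]
  constructor
  · rintro ⟨r, hr, _, ⟨c, hc, rfl⟩, h⟩
    refine ⟨r, hr, T.symm c.1, ⟨sphereMap T.symm c, ?_, rfl⟩, ?_⟩
    · simpa [sphereMap] using hc
    · apply T.injective
      simpa using h
  · rintro ⟨r, hr, _, ⟨c, hc, rfl⟩, rfl⟩
    exact ⟨r, hr, _, ⟨_, hc, rfl⟩, by simp [sphereMap]⟩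

/-- The reflection that changes the sign of one amplitude. -/
def signFlip {n : ℕ} (z : Fin n → Bool) :
    EuclideanSpace ℂ (Fin n → Bool) ≃ₗᵢ[ℝ] EuclideanSpace ℂ (Fin n → Bool) :=
  LinearIsometryEquiv.piLpCongrRight 2 fun x =>
    if x = z then LinearIsometryEquiv.neg ℝ else LinearIsometryEquiv.refl ℝ ℂ

theorem amp_signFlip {n : ℕ} (z x : Fin n → Bool) (c : UnitState n) :
    (sphereMap (signFlip z) c).amp x = if x = z then -c.amp x else c.amp x := by
  simp only [sphereMap, signFlip, UnitState.amp]
  by_cases h : x = z <;> simp [h]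

theorem integrable_amp_mul_star {n : ℕ} (x y : Fin n → Bool) :
    Integrable (fun c : UnitState n => c.amp x * star (c.amp y)) (haarState n) := by
  refine Integrable.of_bound (C := 1) ?_ ?_
  · exact ((continuous_amp x).mul (continuous_amp y).star).aestronglyMeasurable
  · refine ae_of_all _ fun c => ?_
    rw [norm_mul, norm_star]
    exact mul_le_one₀ (norm_amp_le_one _ _) (norm_nonneg _) (norm_amp_le_one _ _)

/-- Distinct amplitudes of a Haar-random state are uncorrelated, because the Haar measure is
invariant under a change of sign of one of them. -/
theorem integral_amp_mul_star_eq_zero {n : ℕ} {x y : Fin n → Bool} (h : x ≠ y) :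
    ∫ c : UnitState n, c.amp x * star (c.amp y) ∂haarState n = 0 := by
  have hmp := measurePreserving_sphereMap (signFlip x)
  have h1 : ∫ c : UnitState n, c.amp x * star (c.amp y) ∂haarState n =
      ∫ c : UnitState n, -(c.amp x * star (c.amp y)) ∂haarState n := by
    conv_lhs => rw [← hmp.map_eq]
    rw [integral_map hmp.measurable.aemeasurable]
    · simp [amp_signFlip, h.symm]
    · exact ((continuous_amp x).mul (continuous_amp y).star).aestronglyMeasurable
  rw [integral_neg] at h1
  exact self_eq_neg.1 h1

/-! ### Independent samples -/

/-- Resampling one of several independent random variables does not change their joint law. -/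
theorem measurePreserving_update {ι X : Type*} [Fintype ι] [DecidableEq ι] [MeasurableSpace X]
    (μ : Measure X) [IsProbabilityMeasure μ] (j : ι) :
    MeasurePreserving (fun p : (ι → X) × X => Function.update p.1 j p.2)
      ((Measure.pi fun _ => μ).prod μ) (Measure.pi fun _ => μ) := by
  have hm : Measurable (fun p : (ι → X) × X => Function.update p.1 j p.2) := by
    refine measurable_pi_lambda _ fun i => ?_
    by_cases h : i = j
    · subst h; simpa using measurable_snd
    · simp only [Function.update_of_ne h]; fun_prop
  refine ⟨hm, (Measure.pi_eq fun s hs => ?_).symm⟩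
  rw [Measure.map_apply hm (MeasurableSet.univ_pi hs)]
  have : (fun p : (ι → X) × X => Function.update p.1 j p.2) ⁻¹' Set.univ.pi s =
      Set.univ.pi (Function.update s j Set.univ) ×ˢ s j := by
    ext p
    simp only [Set.mem_preimage, Set.mem_univ_pi, Set.mem_prod]
    constructor
    · intro h
      refine ⟨fun i => ?_, by simpa using h j⟩
      by_cases hi : i = j
      · subst hi; simp
      · simpa [hi] using h i
    · rintro ⟨h1, h2⟩ i
      by_cases hi : i = j
      · subst hi; simpa using h2
      · simpa [hi] using h1 i
  rw [this, Measure.prod_prod, Measure.pi_pi, ← Finset.mul_prod_erase _ _ (Finset.mem_univ j),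
    ← Finset.mul_prod_erase Finset.univ (fun i => μ (s i)) (Finset.mem_univ j), mul_comm]
  simp only [Function.update_self, measure_univ, one_mul]
  congr 1
  refine Finset.prod_congr rfl fun i hi => ?_
  rw [Function.update_of_ne (Finset.ne_of_mem_erase hi)]

/-- Distinct members of an i.i.d. sample are again an i.i.d. sample. -/
theorem measurePreserving_comp_embedding {ι κ X : Type*} [Fintype ι] [Fintype κ]
    [MeasurableSpace X] (μ : Measure X) [IsProbabilityMeasure μ] (s : ι ↪ κ) :
    MeasurePreserving (fun (c : κ → X) i => c (s i)) (Measure.pi fun _ => μ)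
      (Measure.pi fun _ => μ) := by
  classical
  have hm : Measurable (fun (c : κ → X) i => c (s i)) := by fun_prop
  refine ⟨hm, (Measure.pi_eq fun t ht => ?_).symm⟩
  rw [Measure.map_apply hm (MeasurableSet.univ_pi ht)]
  have : (fun (c : κ → X) i => c (s i)) ⁻¹' Set.univ.pi t =
      Set.univ.pi (Function.extend s t fun _ => Set.univ) := by
    ext c
    simp only [Set.mem_preimage, Set.mem_univ_pi]
    constructor
    · intro h k
      by_cases hk : ∃ i, s i = k
      · obtain ⟨i, rfl⟩ := hk
        rw [s.injective.extend_apply]; exact h i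
      · rw [Function.extend_apply' _ _ _ hk]; trivial
    · intro h i
      have := h (s i)
      rwa [s.injective.extend_apply] at this
  rw [this, Measure.pi_pi, ← Finset.prod_subset (Finset.subset_univ (Finset.univ.map s)),
    Finset.prod_map]
  · simp [s.injective.extend_apply]
  · intro k _ hk
    rw [Function.extend_apply', measure_univ]
    simpa using hk

end

noncomputable section

open scoped ComplexOrder MatrixOrder

/-! ### The test of a single round -/

section Round

variable {V : Type} [Fintype V] [DecidableEq V] {M : ℕ}

/-- The `M + 1` registers of a round before the test: the basis state `|y⟩`, followed by `M` copies
of `r`. -/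
def roundState (M : ℕ) (r : V → ℂ) (y : V) (X : Fin (M + 1) → V) : ℂ :=
  (if X 0 = y then 1 else 0) * ∏ m : Fin M, r (X m.succ)

/-- The registers of a round after the test has accepted: the average of the cyclic shifts of
`roundState`. -/
def testedState (M : ℕ) (r : V → ℂ) (y : V) (X : Fin (M + 1) → V) : ℂ :=
  ((M : ℂ) + 1)⁻¹ * ∑ k : Fin (M + 1), roundState M r y fun s => X (s + k)

/-- The transpose of the projector `|r⟩⟨r|`. -/
def dyad (r : V → ℂ) : Matrix V V ℂ := Matrix.vecMulVec (star r) r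

/-- What the test measures on the returned register alone (transposed): the mixture, with weights
`1 / (M + 1)` and `M / (M + 1)`, of accepting always and of projecting on the response. -/
def testEffect (M : ℕ) (r : V → ℂ) : Matrix V V ℂ :=
  (1 / ((M : ℂ) + 1)) • (1 : Matrix V V ℂ) + ((M : ℂ) / ((M : ℂ) + 1)) • dyad r

theorem roundState_eq_prod {V : Type} [DecidableEq V] (r : V → ℂ) (y : V) (X : Fin (M + 1) → V) :
    roundState M r y X = ∏ s, if s = 0 then (if X s = y then 1 else 0) else r (X s) := by
  simp [roundState, Fin.prod_univ_succ]

theorem sum_prod_pi {ι : Type*} {Z : ι → Type*} [Fintype ι] [DecidableEq ι]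
    [∀ i, Fintype (Z i)] (f : ∀ i, Z i → ℂ) : ∑ X : ∀ i, Z i, ∏ i, f i (X i) = ∏ i, ∑ z, f i z := by
  rw [Finset.prod_univ_sum, Fintype.piFinset_univ]

theorem dotProduct_star_self {V : Type} [Fintype V] {r : V → ℂ} (hr : ∑ q, ‖r q‖ ^ 2 = 1) :
    r ⬝ᵥ star r = 1 := by
  rw [dotProduct, ← Complex.ofReal_one, ← hr, Complex.ofReal_sum]
  refine Finset.sum_congr rfl fun q _ => ?_
  simp [Complex.mul_conj, Complex.normSq_eq_norm_sq]

/-- Overlap of a shifted round state with another one: a nontrivial shift pairs each of the two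
returned registers with a copy of `r`. -/
theorem sum_shift_roundState {r : V → ℂ} (hr : ∑ q, ‖r q‖ ^ 2 = 1) (y y' : V)
    (k : Fin (M + 1)) :
    ∑ X : Fin (M + 1) → V, roundState M r y (fun s => X (s + k)) * star (roundState M r y' X) =
      if k = 0 then (1 : Matrix V V ℂ) y y' else dyad r y y' := by
  have h1 : ∀ X : Fin (M + 1) → V,
      roundState M r y (fun s => X (s + k)) * star (roundState M r y' X) =
      ∏ s, ((if s = k then (if X s = y then 1 else 0) else r (X s)) *
        star (if s = 0 then (if X s = y' then 1 else 0) else r (X s))) := by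
    intro X
    rw [roundState_eq_prod, roundState_eq_prod, star_prod, Finset.prod_mul_distrib]
    congr 1
    rw [← Equiv.prod_comp (Equiv.addRight (-k))]
    simp [← sub_eq_add_neg, sub_eq_zero]
  have hs : ∑ q, r q * star (r q) = 1 := dotProduct_star_self hr
  simp only [h1]
  rw [sum_prod_pi (fun s z => (if s = k then (if z = y then 1 else 0) else r z) *
        star (if s = 0 then (if z = y' then 1 else 0) else r z))]
  by_cases hk : k = 0
  · subst hk
    rw [Fintype.prod_eq_single 0]
    · simp [Matrix.one_apply, eq_comm]
    · intro s hs0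
      simpa [hs0] using hs
  · rw [Fintype.prod_eq_mul 0 k (Ne.symm hk)]
    · simp [hk, Ne.symm hk, dyad, Matrix.vecMulVec_apply, mul_comm]
    · rintro s ⟨hs0, hsk⟩
      simpa [hs0, hsk] using hs

theorem sum_roundState {r : V → ℂ} (hr : ∑ q, ‖r q‖ ^ 2 = 1) (y y' : V) :
    ∑ X : Fin (M + 1) → V, roundState M r y X * star (roundState M r y' X) =
      (1 : Matrix V V ℂ) y y' := by
  simpa using sum_shift_roundState hr y y' (0 : Fin (M + 1))

/-- On the states that occur in a round, the test amounts to `testEffect` on the returned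
register. -/
theorem sum_testedState {r : V → ℂ} (hr : ∑ q, ‖r q‖ ^ 2 = 1) (y y' : V) :
    ∑ X : Fin (M + 1) → V, testedState M r y X * star (testedState M r y' X) =
      testEffect M r y y' := by
  have hM : (M : ℂ) + 1 ≠ 0 := by exact_mod_cast M.succ_ne_zero
  -- the cyclic average is a projection: one of the two averages may be dropped
  have h1 : ∀ k' : Fin (M + 1), ∑ X : Fin (M + 1) → V,
      testedState M r y X * star (roundState M r y' fun s => X (s + k')) =
      ∑ X : Fin (M + 1) → V, testedState M r y X * star (roundState M r y' X) := by
    intro k'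
    refine Fintype.sum_equiv (Equiv.arrowCongr (Equiv.addRight (-k')) (Equiv.refl V)) _ _ ?_
    intro X
    congr 1
    · simp only [testedState]
      congr 1
      refine Fintype.sum_equiv (Equiv.subRight k') _ _ ?_
      intro k
      congr 1
      funext s
      simp [Equiv.arrowCongr]
      congr 1
      abel
    · simp [Equiv.arrowCongr, Function.comp_def]
  have h2 : ∑ X : Fin (M + 1) → V, testedState M r y X * star (roundState M r y' X) =
      testEffect M r y y' := by
    simp only [testedState, Finset.mul_sum, Finset.sum_mul]
    rw [Finset.sum_comm]
    simp only [mul_assoc, ← Finset.mul_sum, sum_shift_roundState hr]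
    rw [Fin.sum_univ_succ]
    simp [testEffect, Fin.succ_ne_zero]
    field_simp
  calc _ = ∑ X : Fin (M + 1) → V, ∑ k', ((M : ℂ) + 1)⁻¹ *
        (testedState M r y X * star (roundState M r y' fun s => X (s + k'))) := by
        refine Finset.sum_congr rfl fun X _ => ?_
        conv_lhs => rw [testedState.eq_1 M r y']
        simp only [star_mul', star_sum, Finset.mul_sum, star_inv₀, star_add, star_one,
          star_natCast]
        refine Finset.sum_congr rfl fun k _ => by ring
    _ = testEffect M r y y' := by
        rw [Finset.sum_comm]
        simp only [← Finset.mul_sum, h1, h2]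
        simp [hM]

/-- Projecting the returned register on `r`: its value is replaced by `q` in one of the two
states. -/
theorem sum_overlap_roundState {r : V → ℂ} (hr : ∑ q, ‖r q‖ ^ 2 = 1) (y y' : V) :
    ∑ X : Fin (M + 1) → V, ∑ q, star (r (X 0)) * r q *
      (roundState M r y X * star (roundState M r y' (Function.update X 0 q))) = dyad r y y' := by
  have hs : ∑ q, r q * star (r q) = 1 := dotProduct_star_self hr
  have h1 : ∀ X : Fin (M + 1) → V, ∑ q, star (r (X 0)) * r q *
      (roundState M r y X * star (roundState M r y' (Function.update X 0 q))) =
      ∏ s, if s = 0 then (if X s = y then star (r y) * r y' else 0)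
        else r (X s) * star (r (X s)) := by
    intro X
    rw [Finset.sum_eq_single y']
    · rw [Fin.prod_univ_succ]
      simp only [roundState, Fin.succ_ne_zero, if_true, if_false, Finset.prod_mul_distrib,
        Function.update_self, star_prod, ne_eq, not_false_eq_true,
        Function.update_of_ne, one_mul]
      by_cases h : X 0 = y <;> simp [h]
    · intro q _ hq
      simp [roundState, hq]
    · simp
  simp only [h1]
  rw [sum_prod_pi (fun s z => if s = 0 then (if z = y then star (r y) * r y' else 0)
        else r z * star (r z)), Fintype.prod_eq_single 0]
  · simp [dyad, Matrix.vecMulVec_apply]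
  · intro s hs0
    simpa [hs0] using hs

theorem posSemidef_dyad {V : Type} [Fintype V] (r : V → ℂ) : (dyad r).PosSemidef := by
  simpa [dyad] using Matrix.posSemidef_vecMulVec_self_star (star r)

theorem posSemidef_one_sub_dyad {r : V → ℂ} (hr : ∑ q, ‖r q‖ ^ 2 = 1) :
    (1 - dyad r).PosSemidef := by
  have hH : (dyad r).IsHermitian := (posSemidef_dyad r).1
  have hP : dyad r * dyad r = dyad r := by
    rw [dyad, Matrix.vecMulVec_mul_vecMulVec, dotProduct_star_self hr]
    simp
  have h := Matrix.posSemidef_conjTranspose_mul_self (1 - dyad r)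
  have h2 : (1 - dyad r).conjTranspose * (1 - dyad r) = 1 - dyad r := by
    rw [Matrix.conjTranspose_sub, hH.eq, Matrix.conjTranspose_one, sub_mul, mul_sub, mul_sub, hP]
    simp
  rwa [h2] at h

theorem posSemidef_testEffect (M : ℕ) (r : V → ℂ) : (testEffect M r).PosSemidef := by
  have h1 : (0 : ℂ) ≤ 1 / ((M : ℂ) + 1) := by
    have : (0 : ℝ) ≤ 1 / ((M : ℝ) + 1) := by positivity
    simpa using Complex.zero_le_real.2 this
  have h2 : (0 : ℂ) ≤ (M : ℂ) / ((M : ℂ) + 1) := by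
    have : (0 : ℝ) ≤ (M : ℝ) / ((M : ℝ) + 1) := by positivity
    simpa using Complex.zero_le_real.2 this
  exact (Matrix.PosSemidef.one.smul h1).add ((posSemidef_dyad r).smul h2)

/-- A test accepts at most everything. -/
theorem posSemidef_one_sub_testEffect (M : ℕ) {r : V → ℂ} (hr : ∑ q, ‖r q‖ ^ 2 = 1) :
    (1 - testEffect M r).PosSemidef := by
  have h2 : (0 : ℂ) ≤ (M : ℂ) / ((M : ℂ) + 1) := by
    have : (0 : ℝ) ≤ (M : ℝ) / ((M : ℝ) + 1) := by positivity
    simpa using Complex.zero_le_real.2 this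
  have hM : (M : ℂ) + 1 ≠ 0 := by exact_mod_cast M.succ_ne_zero
  have h3 : 1 - testEffect M r = ((M : ℂ) / ((M : ℂ) + 1)) • (1 - dyad r) := by
    rw [testEffect, smul_sub]
    have : (1 : Matrix V V ℂ) =
        (1 / ((M : ℂ) + 1)) • (1 : Matrix V V ℂ) + ((M : ℂ) / ((M : ℂ) + 1)) • 1 := by
      rw [← add_smul, ← add_div, add_comm (1 : ℂ), div_self hM, one_smul]
    nth_rw 1 [this]
    abel
  rw [h3]
  exact (posSemidef_one_sub_dyad hr).smul h2

end Round

/-! ### Expectations of product effects -/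

section TensorForm

variable {α ι V : Type} [Fintype α] [Fintype ι] [DecidableEq ι] [Fintype V] [DecidableEq V]

/-- The expectation of the product effect `⨂ i, (G i)ᵀ` on the registers `i : ι` in the pure state
with amplitudes `F`, where `α` indexes a basis of the environment. -/
def tensorForm (F : α → (ι → V) → ℂ) (G : ι → Matrix V V ℂ) : ℂ :=
  ∑ a, ∑ y : ι → V, ∑ y' : ι → V, F a y * star (F a y') * ∏ i, G i (y i) (y' i)

theorem tensorForm_update_add_smul {α ι V : Type} [Fintype α] [Fintype ι] [DecidableEq ι]
    [Fintype V] (F : α → (ι → V) → ℂ) (G : ι → Matrix V V ℂ) (i : ι)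
    (c d : ℂ) (A B : Matrix V V ℂ) :
    tensorForm F (Function.update G i (c • A + d • B)) =
      c * tensorForm F (Function.update G i A) + d * tensorForm F (Function.update G i B) := by
  have h : ∀ (C : Matrix V V ℂ) (y y' : ι → V),
      ∏ j, Function.update G i C j (y j) (y' j) =
        C (y i) (y' i) * ∏ j ∈ Finset.univ.erase i, G j (y j) (y' j) := by
    intro C y y'
    rw [← Finset.mul_prod_erase _ _ (Finset.mem_univ i), Function.update_self]
    congr 1
    refine Finset.prod_congr rfl fun j hj => ?_
    rw [Function.update_of_ne (Finset.ne_of_mem_erase hj)]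
  simp only [tensorForm, h, Finset.mul_sum, ← Finset.sum_add_distrib]
  refine Finset.sum_congr rfl fun a _ => Finset.sum_congr rfl fun y _ =>
    Finset.sum_congr rfl fun y' _ => ?_
  simp only [Matrix.add_apply, Matrix.smul_apply, smul_eq_mul]
  ring

/-- Each positive semidefinite factor is a Gram matrix, which makes the form a sum of squares. -/
theorem tensorForm_nonneg (F : α → (ι → V) → ℂ) {G : ι → Matrix V V ℂ}
    (hG : ∀ i, (G i).PosSemidef) : 0 ≤ tensorForm F G := by
  have : ∀ i, ∃ H : Matrix V V ℂ, G i = H.conjTranspose * H := fun i =>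
    (CStarAlgebra.nonneg_iff_eq_star_mul_self.1 (hG i).nonneg)
  choose H hH using this
  have h1 : ∀ a, ∑ y : ι → V, ∑ y' : ι → V, F a y * star (F a y') * ∏ i, G i (y i) (y' i) =
      ∑ l : ι → V, (∑ y : ι → V, F a y * ∏ i, star (H i (l i) (y i))) *
        star (∑ y : ι → V, F a y * ∏ i, star (H i (l i) (y i))) := by
    intro a
    have h2 : ∀ y y' : ι → V, ∏ i, G i (y i) (y' i) =
        ∑ l : ι → V, ∏ i, (star (H i (l i) (y i)) * H i (l i) (y' i)) := by
      intro y y'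
      rw [sum_prod_pi fun i l => star (H i l (y i)) * H i l (y' i)]
      simp [hH, Matrix.mul_apply, Matrix.conjTranspose_apply]
    simp only [h2, star_sum, Finset.sum_mul_sum]
    simp only [Finset.mul_sum]
    conv_rhs => rw [Finset.sum_comm]
    refine Finset.sum_congr rfl fun y _ => ?_
    conv_rhs => rw [Finset.sum_comm]
    refine Finset.sum_congr rfl fun y' _ => Finset.sum_congr rfl fun l _ => ?_
    simp only [star_mul', star_prod, star_star, Finset.prod_mul_distrib]
    ring
  rw [tensorForm]
  refine Finset.sum_nonneg fun a _ => ?_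
  rw [h1]
  exact Finset.sum_nonneg fun l _ => mul_star_self_nonneg _

/-- Product effects are monotone in each factor. -/
theorem tensorForm_mono (F : α → (ι → V) → ℂ) {G G' : ι → Matrix V V ℂ}
    (hG : ∀ i, (G i).PosSemidef) (hGG' : ∀ i, (G' i - G i).PosSemidef) :
    tensorForm F G ≤ tensorForm F G' := by
  have hG' : ∀ i, (G' i).PosSemidef := fun i => by simpa using (hG i).add (hGG' i)
  have h : ∀ s : Finset ι, tensorForm F G ≤ tensorForm F (s.piecewise G' G) := by
    intro s
    induction s using Finset.induction_on with
    | empty => simp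
    | insert i s hi ih =>
      refine ih.trans ?_
      rw [Finset.piecewise_insert]
      have h1 : G' i = (1 : ℂ) • G i + (1 : ℂ) • (G' i - G i) := by simp
      have h2 : Function.update (s.piecewise G' G) i (G i) = s.piecewise G' G := by
        rw [← Finset.piecewise_eq_of_notMem s G' G hi, Function.update_eq_self]
      rw [h1, tensorForm_update_add_smul, h2, one_mul, one_mul]
      refine le_add_of_nonneg_right (tensorForm_nonneg F fun j => ?_)
      by_cases hj : j = i
      · subst hj; simpa using hGG' j
      · rw [Function.update_of_ne hj]
        by_cases hs : j ∈ s
        · simpa [hs] using hG' j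
        · simpa [hs] using hG j
  simpa using h Finset.univ

end TensorForm

end

noncomputable section

open scoped ComplexOrder MatrixOrder

section TensorForm

variable {α ι V Z : Type} [Fintype α] [Fintype ι] [DecidableEq ι] [Fintype V] [Fintype Z]

/-- A sum over all registers of a product over the registers, for a state expanded in product
states, is computed register by register. -/
theorem sum_expand_eq_tensorForm (F : α → (ι → V) → ℂ) {G : ι → Matrix V V ℂ}
    {w : ι → V → V → Z → ℂ} (hw : ∀ i y y', ∑ z, w i y y' z = G i y y') :
    ∑ a, ∑ X : ι → Z, ∑ y : ι → V, ∑ y' : ι → V,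
      F a y * star (F a y') * ∏ i, w i (y i) (y' i) (X i) = tensorForm F G := by
  rw [tensorForm]
  refine Finset.sum_congr rfl fun a _ => ?_
  rw [Finset.sum_comm]
  refine Finset.sum_congr rfl fun y _ => ?_
  rw [Finset.sum_comm]
  refine Finset.sum_congr rfl fun y' _ => ?_
  rw [← Finset.mul_sum, sum_prod_pi fun i => w i (y i) (y' i)]
  simp only [hw]

theorem sum_norm_sq_eq_tensorForm {F : α → (ι → V) → ℂ} {G : ι → Matrix V V ℂ}
    {v : ι → V → Z → ℂ} {Φ : α → (ι → Z) → ℂ}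
    (hΦ : ∀ a X, Φ a X = ∑ y : ι → V, F a y * ∏ i, v i (y i) (X i))
    (hG : ∀ i y y', ∑ z, v i y z * star (v i y' z) = G i y y') :
    ∑ a, ∑ X : ι → Z, Φ a X * star (Φ a X) = tensorForm F G := by
  rw [← sum_expand_eq_tensorForm F hG]
  refine Finset.sum_congr rfl fun a _ => Finset.sum_congr rfl fun X _ => ?_
  simp only [hΦ, star_sum, Finset.sum_mul_sum]
  refine Finset.sum_congr rfl fun y _ => Finset.sum_congr rfl fun y' _ => ?_
  simp only [star_mul', star_prod, Finset.prod_mul_distrib]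
  ring

/-- The expectation of the projector on `r` in register `i`. The value of that register is read off
by `e` and replaced by `u`. -/
theorem sum_overlap_eq_tensorForm {F : α → (ι → V) → ℂ} {G : ι → Matrix V V ℂ}
    {v : ι → V → Z → ℂ} {Φ : α → (ι → Z) → ℂ} (i : ι) (r : V → ℂ) (e : Z → V) (u : Z → V → Z)
    (hΦ : ∀ a X, Φ a X = ∑ y : ι → V, F a y * ∏ i, v i (y i) (X i))
    (hG : ∀ j ≠ i, ∀ y y', ∑ z, v j y z * star (v j y' z) = G j y y')
    (hi : ∀ y y', ∑ z, ∑ q, star (r (e z)) * r q * (v i y z * star (v i y' (u z q))) =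
      G i y y') :
    ∑ a, ∑ X : ι → Z, ∑ q, star (r (e (X i))) * r q *
      (Φ a X * star (Φ a (Function.update X i (u (X i) q)))) = tensorForm F G := by
  obtain ⟨w, hwi, hwj⟩ : ∃ w : ι → V → V → Z → ℂ,
      (∀ y y' z, w i y y' z = ∑ q, star (r (e z)) * r q * (v i y z * star (v i y' (u z q)))) ∧
      ∀ j ≠ i, ∀ y y' z, w j y y' z = v j y z * star (v j y' z) :=
    ⟨fun j y y' z => if j = i then
      ∑ q, star (r (e z)) * r q * (v i y z * star (v i y' (u z q)))
      else v j y z * star (v j y' z), by simp, fun j hj => by simp [hj]⟩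
  have hw : ∀ j y y', ∑ z, w j y y' z = G j y y' := by
    intro j y y'
    by_cases h : j = i
    · subst h; simpa only [hwi] using hi y y'
    · simpa only [hwj j h] using hG j h y y'
  rw [← sum_expand_eq_tensorForm F hw]
  refine Finset.sum_congr rfl fun a _ => Finset.sum_congr rfl fun X _ => ?_
  simp only [hΦ, star_sum, Finset.sum_mul_sum]
  simp only [Finset.mul_sum]
  rw [Finset.sum_comm]
  refine Finset.sum_congr rfl fun y _ => ?_
  rw [Finset.sum_comm]
  refine Finset.sum_congr rfl fun y' _ => ?_
  rw [← Finset.mul_prod_erase Finset.univ (fun j => w j (y j) (y' j) (X j)) (Finset.mem_univ i),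
    hwi, Finset.sum_mul, Finset.mul_sum]
  refine Finset.sum_congr rfl fun q _ => ?_
  rw [← Finset.mul_prod_erase Finset.univ (fun j => v j (y j) (X j)) (Finset.mem_univ i),
    ← Finset.mul_prod_erase Finset.univ (fun j => v j (y' j) _) (Finset.mem_univ i),
    Function.update_self]
  have h1 : ∏ j ∈ Finset.univ.erase i, v j (y' j) (Function.update X i (u (X i) q) j) =
      ∏ j ∈ Finset.univ.erase i, v j (y' j) (X j) :=
    Finset.prod_congr rfl fun j hj => by rw [Function.update_of_ne (Finset.ne_of_mem_erase hj)]
  have h2 : ∏ j ∈ Finset.univ.erase i, w j (y j) (y' j) (X j) =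
      (∏ j ∈ Finset.univ.erase i, v j (y j) (X j)) *
        star (∏ j ∈ Finset.univ.erase i, v j (y' j) (X j)) := by
    rw [star_prod, ← Finset.prod_mul_distrib]
    exact Finset.prod_congr rfl fun j hj => hwj j (Finset.ne_of_mem_erase hj) _ _ _
  rw [h1, h2]
  simp only [star_mul']
  ring

end TensorForm

/-! ### Norms and reduced states -/

section Wires

variable {A W : Type} [Fintype A] [Fintype W] [DecidableEq A] [DecidableEq W]

theorem normSq_eq_sum_mul_star (ψ : QState W) : (normSq ψ : ℂ) = ∑ x, ψ x * star (ψ x) := by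
  simp [normSq, Complex.mul_conj, Complex.normSq_eq_norm_sq]

theorem star_dotProduct_partialTrace_mulVec (e : A ↪ W) (ψ : QState W) (r : QState A) :
    star r ⬝ᵥ (partialTrace e ψ).mulVec r = ∑ x : W → Bool, ∑ q,
      star (r fun a => x (e a)) * r q * (ψ x * star (ψ (Function.extend e q x))) := by
  simp only [dotProduct, Matrix.mulVec, partialTrace, Finset.mul_sum, Finset.sum_mul]
  have h : ∀ f : (A → Bool) → (A → Bool) → (W → Bool) → ℂ,
      ∑ y, ∑ y', ∑ x, f y y' x = ∑ x, ∑ y', ∑ y, f y y' x := by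
    intro f
    simp only [Finset.sum_comm (s := (Finset.univ : Finset (A → Bool)))
      (t := (Finset.univ : Finset (W → Bool)))]
    exact Finset.sum_congr rfl fun x _ => Finset.sum_comm
  rw [h]
  refine Finset.sum_congr rfl fun x _ => Finset.sum_congr rfl fun q _ => ?_
  rw [Finset.sum_eq_single fun a => x (e a)]
  · simp; ring
  · intro y _ hy
    simp [hy.symm]
  · simp

/-- Exchanging the values on the wires `e` with a labelling of these wires alone. This involution
allows sums over all labellings to be split without choosing an enumeration of the other wires. -/
def wireSwap (e : A ↪ W) : (W → Bool) × (A → Bool) ≃ (W → Bool) × (A → Bool) :=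
  Function.Involutive.toPerm
    (fun p => (Function.extend e p.2 p.1, fun a => p.1 (e a))) <| by
      rintro ⟨x, q⟩
      ext w
      · by_cases hw : ∃ a, e a = w
        · obtain ⟨a, rfl⟩ := hw
          simp [e.injective.extend_apply]
        · simp [Function.extend_apply' _ _ _ hw]
      · simp [e.injective.extend_apply]

theorem extend_extend {A W : Type} (e : A ↪ W) (q q' : A → Bool) (x : W → Bool) :
    Function.extend e q (Function.extend e q' x) = Function.extend e q x := by
  ext w
  by_cases hw : ∃ a, e a = w
  · obtain ⟨a, rfl⟩ := hw
    simp [e.injective.extend_apply]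
  · simp [Function.extend_apply' _ _ _ hw]

theorem sum_norm_sq_mulVec (V : Matrix.unitaryGroup A ℂ) (r : A → ℂ) :
    ∑ x, ‖V.1.mulVec r x‖ ^ 2 = ∑ x, ‖r x‖ ^ 2 := by
  have h : ∀ f : A → ℂ, ((∑ x, ‖f x‖ ^ 2 : ℝ) : ℂ) = star f ⬝ᵥ f := by
    intro f
    simp [dotProduct, mul_comm, Complex.mul_conj, Complex.normSq_eq_norm_sq]
  apply Complex.ofReal_injective
  rw [h, h, Matrix.star_mulVec, ← Matrix.dotProduct_mulVec, Matrix.mulVec_mulVec,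
    ← Matrix.star_eq_conjTranspose, (Matrix.mem_unitaryGroup_iff').1 V.2, Matrix.one_mulVec]

/-- Unitaries on some of the wires preserve the norm. -/
theorem normSq_applyOn (e : A ↪ W) (V : Matrix.unitaryGroup (A → Bool) ℂ) (ψ : QState W) :
    normSq (applyOn e V.1 ψ) = normSq ψ := by
  -- summing in addition over the values `q` of the wires `e` only multiplies the sum by a constant
  have h : ∀ f : (W → Bool) → ℝ, ∑ x : W → Bool, ∑ q : A → Bool, f (Function.extend e q x) =
      Fintype.card (A → Bool) * ∑ x, f x := by
    intro f
    rw [← Fintype.sum_prod_type' (fun x q => f (Function.extend e q x))]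
    rw [show ∑ p : (W → Bool) × (A → Bool), f (Function.extend e p.2 p.1) =
      ∑ p : (W → Bool) × (A → Bool), f p.1 from (wireSwap e).sum_comp fun p => f p.1,
      Fintype.sum_prod_type, Finset.mul_sum]
    simp
  have hc : (Fintype.card (A → Bool) : ℝ) ≠ 0 := by simp
  apply mul_left_cancel₀ hc
  rw [normSq, normSq, ← h, ← h]
  refine Finset.sum_congr rfl fun x _ => ?_
  refine Eq.trans ?_ (sum_norm_sq_mulVec V fun q => ψ (Function.extend e q x))
  simp only [applyOn, extend_extend, e.injective.extend_apply, Matrix.mulVec, dotProduct]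

end Wires

end

noncomputable section

open scoped ComplexOrder MatrixOrder

/-! ### The probability of acceptance -/

/-- A labelling of the wires in the verification phase, given by the values of the adversary's own
qubits and of each register. -/
def verLabel {w n N M : ℕ} : (Fin w → Bool) × (Fin N → Fin (M + 1) → Fin n → Bool) ≃
    (VerWires w n N M → Bool) where
  toFun p := Sum.elim p.1 fun v => p.2 v.1 v.2.1 v.2.2
  invFun x := (fun a => x (Sum.inl a), fun i s b => x (Sum.inr (i, s, b)))
  left_inv _ := rfl
  right_inv x := by ext (_ | _) <;> rfl

theorem verLabel_inr {w n N M : ℕ} (a : Fin w → Bool) (X : Fin N → Fin (M + 1) → Fin n → Bool)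
    (v : Fin N × Fin (M + 1) × Fin n) :
    (verLabel (a, X) : VerWires w n N M → Bool) (Sum.inr v) = X v.1 v.2.1 v.2.2 :=
  rfl

theorem sum_verLabel {w n N M : ℕ} {R : Type*} [AddCommMonoid R]
    (f : (VerWires w n N M → Bool) → R) : ∑ x, f x = ∑ a, ∑ X, f (verLabel (a, X)) := by
  rw [← verLabel.sum_comp, Fintype.sum_prod_type]

theorem extend_verRegister {w n N M : ℕ} (i : Fin N) (s : Fin (M + 1)) (q : Fin n → Bool)
    (a : Fin w → Bool) (X : Fin N → Fin (M + 1) → Fin n → Bool) :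
    Function.extend (verRegister w i s) q (verLabel (a, X)) =
      verLabel (a, Function.update X i (Function.update (X i) s q)) := by
  ext (v | ⟨j, m, b⟩)
  · rw [Function.extend_apply']
    · rfl
    · rintro ⟨b, hb⟩
      cases hb
  · by_cases h : j = i ∧ m = s
    · obtain ⟨rfl, rfl⟩ := h
      refine ((verRegister w j m).injective.extend_apply q _ b).trans ?_
      simp [verLabel_inr]
    · rw [Function.extend_apply']
      · by_cases hj : j = i
        · subst hj
          have hm : m ≠ s := fun hm => h ⟨rfl, hm⟩
          simp [verLabel_inr, hm]
        · simp [verLabel_inr, hj]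
      · rintro ⟨b', hb⟩
        simp only [verRegister, Function.Embedding.trans_apply, Function.Embedding.sectR_apply,
          Function.Embedding.inr_apply, Sum.inr.injEq, Prod.mk.injEq] at hb
        exact h ⟨hb.1.symm, hb.2.1.symm⟩

theorem gswap_verLabel {w n N M : ℕ} (i : Fin N) (Φ : QState (VerWires w n N M))
    (a : Fin w → Bool) (X : Fin N → Fin (M + 1) → Fin n → Bool) :
    gswap i Φ (verLabel (a, X)) = ((M : ℂ) + 1)⁻¹ *
      ∑ k, Φ (verLabel (a, Function.update X i fun s => X i (s + k))) := by
  have hM : (√((M : ℝ) + 1) : ℂ) * √((M : ℝ) + 1) = (M : ℂ) + 1 := by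
    rw [← Complex.ofReal_mul, Real.mul_self_sqrt (by positivity)]
    push_cast; rfl
  rw [gswap, Finset.mul_sum]
  refine Finset.sum_congr rfl fun k _ => ?_
  rw [← mul_assoc, one_div, ← mul_inv, hM]
  congr 2
  ext (v | ⟨j, m, b⟩)
  · rfl
  · by_cases hj : j = i
    · subst hj; simp [verLabel_inr, shiftWires]
    · simp [verLabel_inr, shiftWires, hj]

theorem sum_norm_response_sq {n : ℕ} (U : QUnitary n) (c : UnitState n) :
    ∑ q, ‖response U c q‖ ^ 2 = 1 := by
  rw [response, sum_norm_sq_mulVec, sum_norm_amp_sq]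

theorem fidelity_sq {A : Type} [Fintype A] [DecidableEq A] {ρ : Matrix (A → Bool) (A → Bool) ℂ}
    {ψ : QState A} (h : 0 ≤ star ψ ⬝ᵥ ρ.mulVec ψ) :
    ((fidelity ρ ψ ^ 2 : ℝ) : ℂ) = star ψ ⬝ᵥ ρ.mulVec ψ := by
  rw [fidelity, Real.sq_sqrt (Complex.le_def.1 h).1]
  exact (Complex.eq_re_of_ofReal_le h).symm

namespace Adversary

variable {n N : ℕ} (A : Adversary n N) (M : ℕ) (U : QUnitary n) (c : Fin N → UnitState n)

/-- The final amplitudes of the attack, with the returned registers separated from the adversary's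
own qubits. -/
def amplitude (a : Fin A.work → Bool) (y : Fin N → Fin n → Bool) : ℂ :=
  A.final U c (Sum.elim a fun p => y p.1 p.2)

/-- The effects measured by the tests of the first `t` rounds. -/
def effects (t : ℕ) (i : Fin N) : Matrix (Fin n → Bool) (Fin n → Bool) ℂ :=
  if i.val < t then testEffect M (response U (c i)) else 1

/-- The registers of round `i` when the tests of the first `t` rounds have accepted, as a function
of the value `y` that the returned register had before verification. -/
def roundAfter (t : ℕ) (i : Fin N) (y : Fin n → Bool) : (Fin (M + 1) → Fin n → Bool) → ℂ :=
  if i.val < t then testedState M (response U (c i)) y else roundState M (response U (c i)) y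

theorem verInitial_verLabel (a : Fin A.work → Bool) (X : Fin N → Fin (M + 1) → Fin n → Bool) :
    A.verInitial M U c (verLabel (a, X)) =
      ∑ y : Fin N → Fin n → Bool, A.amplitude U c a y *
        ∏ i, roundState M (response U (c i)) (y i) (X i) := by
  rw [Finset.sum_eq_single fun i => X i 0]
  · simp only [roundState, if_true, one_mul]
    simp only [verInitial, amplitude]
    congr 2
    ext (v | ⟨j, b⟩) <;> rfl
  · intro y _ hy
    obtain ⟨i, hi⟩ := Function.ne_iff.1 hy
    rw [Finset.prod_eq_zero (Finset.mem_univ i), mul_zero]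
    simp [roundState, hi.symm]
  · simp

theorem passed_succ {t : ℕ} (ht : t < N) :
    A.passed M U c (t + 1) = gswap ⟨t, ht⟩ (A.passed M U c t) := by
  rw [passed, List.take_succ_eq_append_getElem (by simpa using ht), List.foldl_append]
  simp [passed]

/-- The state after `t` accepted tests, expanded in states that are products over the rounds. -/
theorem passed_verLabel {t : ℕ} (ht : t ≤ N) (a : Fin A.work → Bool)
    (X : Fin N → Fin (M + 1) → Fin n → Bool) :
    A.passed M U c t (verLabel (a, X)) =
      ∑ y : Fin N → Fin n → Bool, A.amplitude U c a y *
        ∏ i, roundAfter M U c t i (y i) (X i) := by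
  induction t generalizing X with
  | zero => simpa [passed, roundAfter] using A.verInitial_verLabel M U c a X
  | succ t ih =>
    rw [passed_succ A M U c ht, gswap_verLabel]
    simp only [ih (Nat.le_of_succ_le ht)]
    rw [Finset.sum_comm, Finset.mul_sum]
    refine Finset.sum_congr rfl fun y _ => ?_
    rw [← Finset.mul_sum, mul_left_comm]
    congr 1
    set i : Fin N := ⟨t, ht⟩
    rw [← Finset.mul_prod_erase Finset.univ (fun j => roundAfter M U c (t + 1) j (y j) (X j))
      (Finset.mem_univ i)]
    have h1 : ∀ k, ∏ j, roundAfter M U c t j (y j)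
        (Function.update X i (fun s => X i (s + k)) j) =
        roundState M (response U (c i)) (y i) (fun s => X i (s + k)) *
          ∏ j ∈ Finset.univ.erase i, roundAfter M U c (t + 1) j (y j) (X j) := by
      intro k
      rw [← Finset.mul_prod_erase _ _ (Finset.mem_univ i), Function.update_self]
      congr 1
      · simp [roundAfter, i]
      · refine Finset.prod_congr rfl fun j hj => ?_
        have hj := Finset.ne_of_mem_erase hj
        have hjt : j.val ≠ t := fun h => hj (Fin.ext h)
        rw [Function.update_of_ne hj]
        have : j.val < t + 1 ↔ j.val < t := by omega
        simp only [roundAfter, this]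
    simp only [h1, ← Finset.sum_mul, ← mul_assoc]
    congr 1
    simp [roundAfter, i, testedState]

/-- The probability that the first `t` tests accept. -/
theorem normSq_passed {t : ℕ} (ht : t ≤ N) :
    (normSq (A.passed M U c t) : ℂ) = tensorForm (A.amplitude U c) (effects M U c t) := by
  rw [normSq_eq_sum_mul_star, sum_verLabel]
  refine sum_norm_sq_eq_tensorForm (v := roundAfter M U c t)
    (fun a X => A.passed_verLabel M U c ht a X) fun i y y' => ?_
  simp only [roundAfter, effects]
  split_ifs
  · exact sum_testedState (sum_norm_response_sq U (c i)) y y'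
  · exact sum_roundState (sum_norm_response_sq U (c i)) y y'

/-- The register that enters the test of round `i` has not been touched by the earlier tests, so its
overlap with the response only replaces the `i`-th effect by a projector. -/
theorem overlap_passed (i : Fin N) :
    star (response U (c i)) ⬝ᵥ
      (partialTrace (verRegister A.work i 0) (A.passed M U c i)).mulVec (response U (c i)) =
      tensorForm (A.amplitude U c)
        (Function.update (effects M U c i) i (dyad (response U (c i)))) := by
  rw [star_dotProduct_partialTrace_mulVec, sum_verLabel]
  simp only [extend_verRegister]
  refine sum_overlap_eq_tensorForm (v := roundAfter M U c i) i (response U (c i)) (fun Z => Z 0)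
    (fun Z q => Function.update Z 0 q)
    (fun a X => A.passed_verLabel M U c i.2.le a X) (fun j hj y y' => ?_) fun y y' => ?_
  · rw [Function.update_of_ne hj]
    simp only [roundAfter, effects]
    split_ifs
    · exact sum_testedState (sum_norm_response_sq U (c j)) y y'
    · exact sum_roundState (sum_norm_response_sq U (c j)) y y'
  · rw [Function.update_self]
    simp only [roundAfter, lt_irrefl, if_false]
    exact sum_overlap_roundState (sum_norm_response_sq U (c i)) y y'

end Adversary

end

noncomputable section

open scoped ComplexOrder MatrixOrder

/-- A labelling of the adversary's wires, given by the values of her own qubits and of the register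
of each round. -/
def wireLabel {w n N : ℕ} : (Fin w → Bool) × (Fin N → Fin n → Bool) ≃
    (Fin w ⊕ (Fin N × Fin n) → Bool) where
  toFun p := Sum.elim p.1 fun v => p.2 v.1 v.2
  invFun x := (fun a => x (Sum.inl a), fun i b => x (Sum.inr (i, b)))
  left_inv _ := rfl
  right_inv x := by ext (_ | _) <;> rfl

theorem wireLabel_inr {w n N : ℕ} (a : Fin w → Bool) (y : Fin N → Fin n → Bool)
    (v : Fin N × Fin n) :
    (wireLabel (a, y) : Fin w ⊕ (Fin N × Fin n) → Bool) (Sum.inr v) = y v.1 v.2 :=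
  rfl

theorem sum_wireLabel {w n N : ℕ} {R : Type*} [AddCommMonoid R]
    (f : (Fin w ⊕ (Fin N × Fin n) → Bool) → R) : ∑ x, f x = ∑ a, ∑ y, f (wireLabel (a, y)) := by
  rw [← wireLabel.sum_comp, Fintype.sum_prod_type]

theorem normSq_zeroState (W : Type) [Fintype W] [DecidableEq W] : normSq (zeroState W) = 1 := by
  simp [normSq, zeroState, apply_ite]

theorem LocalGate.normSq_apply {W : Type} [Fintype W] [DecidableEq W] (g : LocalGate W)
    (ψ : QState W) : normSq (g.apply ψ) = normSq ψ :=
  normSq_applyOn g.wires g.op ψ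

theorem OracleGate.normSq_apply {n : ℕ} {W : Type} [Fintype W] [DecidableEq W] (U : QUnitary n)
    (g : OracleGate n W) (ψ : QState W) : normSq (g.apply U ψ) = normSq ψ := by
  cases g with
  | gate g => exact g.normSq_apply ψ
  | query e => exact normSq_applyOn e U ψ

namespace Adversary

variable {n N : ℕ} (A : Adversary n N) (M : ℕ) (U : QUnitary n) (c : Fin N → UnitState n)

theorem normSq_learned : normSq (A.learned U) = 1 := by
  rw [learned, ← normSq_zeroState (Fin A.work)]
  generalize zeroState (Fin A.work) = ψ
  induction A.learn generalizing ψ with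
  | nil => rfl
  | cons g l ih => rw [List.foldl_cons, ih, g.normSq_apply]

theorem normSq_initial : normSq (A.initial U c) = 1 := by
  have h : ∀ i, ∑ q, ‖(c i).amp q‖ ^ 2 = 1 := fun i => sum_norm_amp_sq (c i)
  have h1 := A.normSq_learned U
  rw [normSq] at h1 ⊢
  rw [sum_wireLabel, ← h1]
  refine Finset.sum_congr rfl fun a _ => ?_
  have h2 : ∀ y, ‖A.initial U c (wireLabel (a, y))‖ ^ 2 =
      ‖A.learned U a‖ ^ 2 * ∏ i, ‖(c i).amp (y i)‖ ^ 2 := by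
    intro y
    rw [Finset.prod_pow, ← mul_pow, ← norm_prod, ← norm_mul]
    rfl
  simp only [h2, ← Finset.mul_sum]
  have h3 := Finset.prod_univ_sum (fun _ : Fin N => (Finset.univ : Finset (Fin n → Bool)))
    fun i q => ‖(c i).amp q‖ ^ 2
  rw [Fintype.piFinset_univ] at h3
  rw [← h3]
  simp [h]

theorem normSq_final : normSq (A.final U c) = 1 := by
  rw [final, ← A.normSq_initial U c]
  generalize A.initial U c = ψ
  induction List.finRange N generalizing ψ with
  | nil => rfl
  | cons i l ih =>
    rw [List.foldl_cons, ih]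
    induction A.answer i generalizing ψ with
    | nil => rfl
    | cons g l ih => rw [List.foldl_cons, ih, LocalGate.normSq_apply]

theorem final_wireLabel (a : Fin A.work → Bool) (X : Fin N → Fin n → Bool) :
    A.final U c (wireLabel (a, X)) = ∑ y : Fin N → Fin n → Bool, A.amplitude U c a y *
      ∏ i, if X i = y i then 1 else 0 := by
  rw [Finset.sum_eq_single X]
  · rw [Finset.prod_eq_one fun i _ => if_pos rfl, mul_one]
    rfl
  · intro y _ hy
    obtain ⟨i, hi⟩ := Function.ne_iff.1 hy
    rw [Finset.prod_eq_zero (Finset.mem_univ i), mul_zero]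
    simp [hi.symm]
  · simp

/-- The final state of the attack is normalised. -/
theorem tensorForm_one : tensorForm (A.amplitude U c) (fun _ => 1) = 1 := by
  have h := normSq_eq_sum_mul_star (A.final U c)
  rw [normSq_final, sum_wireLabel, sum_norm_sq_eq_tensorForm
    (v := fun _ y X => if X = y then 1 else 0) (A.final_wireLabel U c) (G := fun _ => 1)] at h
  · simpa using h.symm
  · intro i y y'
    simp [Matrix.one_apply, eq_comm]

theorem extend_register (i : Fin N) (q : Fin n → Bool) (a : Fin A.work → Bool)
    (X : Fin N → Fin n → Bool) : Function.extend (A.register i) q (wireLabel (a, X)) =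
      wireLabel (a, Function.update X i q) := by
  ext (v | ⟨j, b⟩)
  · rw [Function.extend_apply']
    · rfl
    · rintro ⟨b, hb⟩
      cases hb
  · by_cases h : j = i
    · subst h
      refine ((A.register j).injective.extend_apply q _ b).trans ?_
      simp [wireLabel_inr]
    · rw [Function.extend_apply']
      · simp [wireLabel_inr, h]
      · rintro ⟨b', hb⟩
        simp only [register, Function.Embedding.trans_apply, Function.Embedding.sectR_apply,
          Function.Embedding.inr_apply, Sum.inr.injEq, Prod.mk.injEq] at hb
        exact h hb.1.symm

theorem overlap_returned (i : Fin N) (r : QState (Fin n)) :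
    star r ⬝ᵥ (A.returned U c i).mulVec r =
      tensorForm (A.amplitude U c) (Function.update (fun _ => 1) i (dyad r)) := by
  rw [returned, star_dotProduct_partialTrace_mulVec, sum_wireLabel]
  simp only [extend_register]
  refine sum_overlap_eq_tensorForm (v := fun _ y X => if X = y then 1 else 0) i r (fun q => q)
    (fun _ q => q) (A.final_wireLabel U c) (fun j hj y y' => ?_) fun y y' => ?_
  · rw [Function.update_of_ne hj]
    simp [Matrix.one_apply, eq_comm]
  · rw [Function.update_self, Finset.sum_eq_single y, Finset.sum_eq_single y']
    · simp [dyad, Matrix.vecMulVec_apply]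
    all_goals simp +contextual

theorem fidelity_returned_sq (i : Fin N) (r : QState (Fin n)) :
    ((fidelity (A.returned U c i) r ^ 2 : ℝ) : ℂ) =
      tensorForm (A.amplitude U c) (Function.update (fun _ => 1) i (dyad r)) := by
  rw [← overlap_returned]
  refine fidelity_sq ?_
  rw [overlap_returned]
  refine tensorForm_nonneg _ fun j => ?_
  by_cases hj : j = i
  · subst hj; simpa using posSemidef_dyad r
  · simpa [hj] using Matrix.PosSemidef.one

theorem posSemidef_effects (t : ℕ) (i : Fin N) : (effects M U c t i).PosSemidef := by
  rw [effects]
  split_ifs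
  · exact posSemidef_testEffect _ _
  · exact Matrix.PosSemidef.one

theorem posSemidef_update_effects (t : ℕ) (i j : Fin N) :
    (Function.update (effects M U c t) i (dyad (response U (c i))) j).PosSemidef := by
  by_cases hj : j = i
  · subst hj; simpa using posSemidef_dyad _
  · simpa [hj] using posSemidef_effects M U c t j

/-- The probability that the tests of the rounds before `i` accept and that the `i`-th returned
register is then found in the correct response. -/
def hit (i : Fin N) : ℝ :=
  (tensorForm (A.amplitude U c)
    (Function.update (effects M U c i) i (dyad (response U (c i))))).re

theorem ofReal_hit (i : Fin N) : (A.hit M U c i : ℂ) = tensorForm (A.amplitude U c)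
    (Function.update (effects M U c i) i (dyad (response U (c i)))) :=
  (Complex.eq_re_of_ofReal_le
    (tensorForm_nonneg _ (posSemidef_update_effects M U c i i))).symm

theorem hit_nonneg (i : Fin N) : 0 ≤ A.hit M U c i :=
  (Complex.le_def.1 (tensorForm_nonneg _ (posSemidef_update_effects M U c i i))).1

/-- The earlier tests can only decrease the weight of a correct answer. -/
theorem hit_le (i : Fin N) :
    A.hit M U c i ≤ fidelity (A.returned U c i) (response U (c i)) ^ 2 := by
  rw [← Complex.real_le_real, ofReal_hit, fidelity_returned_sq]
  refine tensorForm_mono _ (posSemidef_update_effects M U c i i) fun j => ?_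
  by_cases hj : j = i
  · subst hj; simpa using Matrix.PosSemidef.zero
  · simp only [Function.update_of_ne hj, effects]
    split_ifs
    · exact posSemidef_one_sub_testEffect M (sum_norm_response_sq U (c j))
    · simpa using Matrix.PosSemidef.zero

theorem normSq_passed_zero : normSq (A.passed M U c 0) = 1 := by
  have h := A.normSq_passed M U c (Nat.zero_le N)
  have h0 : effects M U c 0 = fun _ => 1 := by ext1 i; simp [effects]
  rw [h0, tensorForm_one] at h
  exact_mod_cast h

/-- A further test accepts always with weight `1 / (M + 1)`, and projects on the response with
weight `M / (M + 1)`. -/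
theorem normSq_passed_succ (i : Fin N) :
    normSq (A.passed M U c (i + 1)) = 1 / ((M : ℝ) + 1) * normSq (A.passed M U c i) +
      (M : ℝ) / ((M : ℝ) + 1) * A.hit M U c i := by
  have h1 : effects M U c (i + 1) =
      Function.update (effects M U c i) i (testEffect M (response U (c i))) := by
    ext1 j
    by_cases hj : j = i
    · subst hj; simp [effects]
    · have hji : j.val ≠ i.val := fun h => hj (Fin.ext h)
      have : j.val < i.val + 1 ↔ j.val < i.val := by omega
      simp [effects, hj, this]
  have h2 : Function.update (effects M U c i) i 1 = effects M U c i := by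
    rw [Function.update_eq_self_iff]
    simp [effects]
  apply Complex.ofReal_injective
  push_cast
  rw [A.normSq_passed M U c i.2, h1, testEffect, tensorForm_update_add_smul, h2, ofReal_hit,
    A.normSq_passed M U c i.2.le]

theorem fidelity_tested_sq (i : Fin N) :
    fidelity (A.tested M U c i) (response U (c i)) ^ 2 =
      (normSq (A.passed M U c i))⁻¹ * A.hit M U c i := by
  have h0 : 0 ≤ normSq (A.passed M U c i) := Finset.sum_nonneg fun _ _ => by positivity
  have h : star (response U (c i)) ⬝ᵥ (A.tested M U c i).mulVec (response U (c i)) =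
      (((normSq (A.passed M U c i))⁻¹ * A.hit M U c i : ℝ) : ℂ) := by
    rw [tested, Matrix.smul_mulVec, dotProduct_smul, overlap_passed, ← ofReal_hit, smul_eq_mul,
      Complex.ofReal_mul]
  apply Complex.ofReal_injective
  rw [fidelity_sq, h]
  rw [h]
  exact Complex.zero_le_real.2 (mul_nonneg (inv_nonneg.2 h0) (A.hit_nonneg M U c i))

theorem normSq_passed_eq_prod {t : ℕ} (ht : t ≤ N) : normSq (A.passed M U c t) =
    ∏ j ∈ Finset.range t, if hj : j < N then 1 / ((M : ℝ) + 1) + (M : ℝ) / ((M : ℝ) + 1) *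
      fidelity (A.tested M U c ⟨j, hj⟩) (response U (c ⟨j, hj⟩)) ^ 2 else 1 := by
  induction t with
  | zero => simpa using A.normSq_passed_zero M U c
  | succ t ih =>
    have ih := ih (Nat.le_of_succ_le ht)
    -- no factor vanishes, so that conditioning on the earlier tests is never vacuous
    have hpos : 0 < normSq (A.passed M U c t) := by
      rw [ih]
      refine Finset.prod_pos fun j _ => ?_
      split_ifs <;> positivity
    rw [Finset.prod_range_succ, ← ih, dif_pos (Nat.lt_of_succ_le ht), fidelity_tested_sq,
      A.normSq_passed_succ M U c ⟨t, ht⟩]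
    field_simp

theorem acceptProb_eq_prod_tested : A.acceptProb M U c =
    ∏ i, (1 / ((M : ℝ) + 1) + (M : ℝ) / ((M : ℝ) + 1) *
      fidelity (A.tested M U c i) (response U (c i)) ^ 2) := by
  rw [acceptProb, normSq_passed_eq_prod A M U c le_rfl, Finset.prod_range]
  simp

/-- The adversary is accepted either by luck in all rounds, or because some returned register
overlaps with the correct response. -/
theorem acceptProb_le : A.acceptProb M U c ≤ (((M : ℝ) + 1) ^ N)⁻¹ +
    ∑ i, fidelity (A.returned U c i) (response U (c i)) ^ 2 := by
  have h : ∀ t ≤ N, normSq (A.passed M U c t) ≤ (((M : ℝ) + 1) ^ t)⁻¹ +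
      ∑ j ∈ Finset.range t, if hj : j < N then
        fidelity (A.returned U c ⟨j, hj⟩) (response U (c ⟨j, hj⟩)) ^ 2 else 0 := by
    intro t ht
    induction t with
    | zero => simpa using (A.normSq_passed_zero M U c).le
    | succ t ih =>
      have ih := ih (Nat.le_of_succ_le ht)
      have h1 := A.hit_le M U c ⟨t, ht⟩
      have h2 := A.hit_nonneg M U c ⟨t, ht⟩
      rw [Finset.sum_range_succ, dif_pos (Nat.lt_of_succ_le ht), A.normSq_passed_succ M U c ⟨t, ht⟩]
      set S := ∑ j ∈ Finset.range t, if hj : j < N then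
        fidelity (A.returned U c ⟨j, hj⟩) (response U (c ⟨j, hj⟩)) ^ 2 else 0
      have hS : 0 ≤ S := Finset.sum_nonneg fun j _ => by split_ifs <;> positivity
      have hM1 : 1 / ((M : ℝ) + 1) ≤ 1 := by
        rw [div_le_one (by positivity)]; simp
      have hM2 : (M : ℝ) / ((M : ℝ) + 1) ≤ 1 := by
        rw [div_le_one (by positivity)]; simp
      have h3 := mul_le_mul_of_nonneg_left ih (show 0 ≤ 1 / ((M : ℝ) + 1) by positivity)
      have h4 := mul_le_mul_of_nonneg_right hM2 h2
      have h5 := mul_le_mul_of_nonneg_right hM1 hS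
      have h6 : (((M : ℝ) + 1) ^ (t + 1))⁻¹ = 1 / ((M : ℝ) + 1) * (((M : ℝ) + 1) ^ t)⁻¹ := by
        rw [pow_succ, mul_inv, one_div, mul_comm]
      rw [h6]
      linarith
  refine (h N le_rfl).trans (le_of_eq ?_)
  rw [Finset.sum_range]
  simp

theorem acceptProb_nonneg : 0 ≤ A.acceptProb M U c := Finset.sum_nonneg fun _ _ => by positivity

theorem jointReturned_eq (y y' : Fin N → Fin n → Bool) :
    A.jointReturned U c (fun p => y p.1 p.2) (fun p => y' p.1 p.2) =
      ∑ a, A.amplitude U c a y * star (A.amplitude U c a y') := by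
  rw [jointReturned, partialTrace, sum_wireLabel]
  refine Finset.sum_congr rfl fun a _ => ?_
  rw [Finset.sum_eq_single y]
  · rw [if_pos (by rfl)]
    congr 2
    rw [amplitude]
    congr 1
    ext (v | p)
    · rw [Function.extend_apply']
      · rfl
      · simp
    · exact Sum.inr_injective.extend_apply _ _ p
  · intro z _ hz
    rw [if_neg]
    intro h
    apply hz
    funext i b
    exact congrFun h (i, b)
  · simp

theorem trace_returned (i : Fin N) : (A.returned U c i).trace = 1 := by
  have h := normSq_eq_sum_mul_star (A.final U c)
  rw [normSq_final] at h
  simp only [Matrix.trace, Matrix.diag, returned, partialTrace]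
  rw [Finset.sum_comm, ← Complex.ofReal_one, h]
  refine Finset.sum_congr rfl fun x _ => ?_
  rw [Finset.sum_ite_eq, if_pos (Finset.mem_univ _)]
  congr 3
  ext w
  by_cases hw : ∃ b, A.register i b = w
  · obtain ⟨b, rfl⟩ := hw
    exact (A.register i).injective.extend_apply _ _ b
  · rw [Function.extend_apply' _ _ _ hw]

theorem acceptProb_eq_prod_returned (h : A.IsProduct U c) : A.acceptProb M U c =
    ∏ i, (1 / ((M : ℝ) + 1) + (M : ℝ) / ((M : ℝ) + 1) *
      fidelity (A.returned U c i) (response U (c i)) ^ 2) := by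
  have h1 : ∀ i, ∑ q, ∑ q', A.returned U c i q q' * testEffect M (response U (c i)) q q' =
      1 / ((M : ℂ) + 1) + (M : ℂ) / ((M : ℂ) + 1) *
        ((fidelity (A.returned U c i) (response U (c i)) ^ 2 : ℝ) : ℂ) := by
    intro i
    rw [fidelity_returned_sq, ← overlap_returned]
    simp only [testEffect, Matrix.add_apply, Matrix.smul_apply, smul_eq_mul, mul_add,
      Finset.sum_add_distrib]
    congr 1
    · have := A.trace_returned U c i
      rw [Matrix.trace] at this
      simp only [Matrix.one_apply, mul_ite, mul_one, mul_zero, Finset.sum_ite_eq,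
        Finset.mem_univ, if_true]
      rw [← Finset.sum_mul]
      simp only [Matrix.diag] at this
      rw [this, one_mul]
    · simp only [dotProduct, Matrix.mulVec, Finset.mul_sum, dyad, Matrix.vecMulVec_apply]
      refine Finset.sum_congr rfl fun q _ => Finset.sum_congr rfl fun q' _ => ?_
      ring
  apply Complex.ofReal_injective
  push_cast
  rw [acceptProb, normSq_passed A M U c le_rfl]
  have h2 : effects M U c N = fun i => testEffect M (response U (c i)) := by
    ext1 i; simp [effects]
  have h3 : ∀ y y' : Fin N → Fin n → Bool,
      ∑ a, A.amplitude U c a y * star (A.amplitude U c a y') =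
        ∏ i, A.returned U c i (y i) (y' i) := by
    intro y y'
    rw [← jointReturned_eq, h]
  rw [h2, tensorForm, Finset.sum_comm]
  simp only [Finset.sum_comm (s := (Finset.univ : Finset (Fin A.work → Bool))), ← Finset.sum_mul,
    h3, ← Finset.prod_mul_distrib]
  have h4 : ∀ y : Fin N → Fin n → Bool, ∑ y' : Fin N → Fin n → Bool,
      ∏ i, A.returned U c i (y i) (y' i) * testEffect M (response U (c i)) (y i) (y' i) =
      ∏ i, ∑ q', A.returned U c i (y i) q' * testEffect M (response U (c i)) (y i) q' := fun y =>
    sum_prod_pi fun i q' => A.returned U c i (y i) q' * testEffect M (response U (c i)) (y i) q'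
  simp only [h4]
  rw [sum_prod_pi fun i q => ∑ q', A.returned U c i q q' * testEffect M (response U (c i)) q q']
  exact_mod_cast Finset.prod_congr rfl fun i _ => h1 i

end Adversary

end

noncomputable section

/-! ### Reduction to a single challenge -/

section Relabel

variable {A V W : Type} [Fintype A] [DecidableEq A]

theorem extend_trans_comp {A V W : Type} (e : A ↪ V) (f : V ↪ W) (y : A → Bool) (x : W → Bool) :
    (fun v => Function.extend (e.trans f) y x (f v)) = Function.extend e y fun v => x (f v) := by
  ext v
  by_cases hv : ∃ a, e a = v
  · obtain ⟨a, rfl⟩ := hv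
    rw [e.injective.extend_apply]
    exact (e.trans f).injective.extend_apply y x a
  · rw [Function.extend_apply' _ _ _ hv, Function.extend_apply']
    rintro ⟨a, ha⟩
    exact hv ⟨a, f.injective ha⟩

/-- An operator on the wires `f v` acts on the first factor of a product state, the second factor
of which only involves the other wires. -/
theorem applyOn_trans (e : A ↪ V) (f : V ↪ W) (T : Matrix (A → Bool) (A → Bool) ℂ) (ψ : QState V)
    {g : QState W} (hg : ∀ x x' : W → Bool, (∀ w, (∀ v, f v ≠ w) → x w = x' w) → g x = g x') :
    applyOn (e.trans f) T (fun x => ψ (fun v => x (f v)) * g x) =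
      fun x => applyOn e T ψ (fun v => x (f v)) * g x := by
  ext x
  simp only [applyOn, Finset.sum_mul, extend_trans_comp]
  refine Finset.sum_congr rfl fun y _ => ?_
  rw [← mul_assoc, hg (Function.extend (e.trans f) y x) x]
  · rfl
  · intro w hw
    rw [Function.extend_apply']
    rintro ⟨a, ha⟩
    exact hw _ ha

/-- The same gate or query on relabelled wires. -/
def OracleGate.relabel {n : ℕ} (f : V ↪ W) : OracleGate n V → OracleGate n W
  | .gate g => .gate (g.relabel f)
  | .query e => .query (e.trans f)

theorem OracleGate.relabel_apply {n : ℕ} (U : QUnitary n) (f : V ↪ W) (o : OracleGate n V)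
    (ψ : QState V) {g : QState W}
    (hg : ∀ x x' : W → Bool, (∀ w, (∀ v, f v ≠ w) → x w = x' w) → g x = g x') :
    (o.relabel f).apply U (fun x => ψ (fun v => x (f v)) * g x) =
      fun x => o.apply U ψ (fun v => x (f v)) * g x := by
  cases o with
  | gate o => exact applyOn_trans o.wires f o.op.1 ψ hg
  | query e => exact applyOn_trans e f U.1 ψ hg

theorem LocalGate.relabel_trans_apply {V' : Type} (f : V ↪ V') (σ : V' ≃ W) (o : LocalGate V)
    (ψ : QState V') : (o.relabel (f.trans σ.toEmbedding)).apply (fun x => ψ (fun v => x (σ v))) =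
      fun x => (o.relabel f).apply ψ (fun v => x (σ v)) := by
  have := applyOn_trans (o.wires.trans f) σ.toEmbedding o.op.1 ψ (g := fun _ => 1)
    fun _ _ _ => rfl
  simp only [mul_one] at this
  exact this

/-- Reduced states do not depend on the names of the wires. -/
theorem partialTrace_trans [Fintype V] [DecidableEq V] [Fintype W] [DecidableEq W] (e : A ↪ V)
    (σ : V ≃ W) (ψ : QState V) :
    partialTrace (e.trans σ.toEmbedding) (fun x => ψ (fun v => x (σ v))) = partialTrace e ψ := by
  ext y y'
  rw [partialTrace, partialTrace]
  refine Fintype.sum_equiv (σ.symm.arrowCongr (Equiv.refl Bool)) _ _ fun x => ?_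
  have h := extend_trans_comp e σ.toEmbedding y' x
  simp only [Equiv.coe_toEmbedding] at h
  rw [h]
  rfl

end Relabel

/-- The gate that flips the qubit `w` if `b` is `true`. -/
def flipGate {W : Type} (w : W) (b : Bool) : LocalGate W where
  arity := 1
  arity_le := by norm_num
  wires := ⟨fun _ => w, fun _ _ _ => Subsingleton.elim _ _⟩
  op := ⟨Matrix.of fun x y => if y 0 = xor (x 0) b then 1 else 0, by
    rw [Matrix.mem_unitaryGroup_iff]
    ext x y
    rw [Matrix.mul_apply, Finset.sum_eq_single fun _ => xor (x 0) b]
    · by_cases h : x = y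
      · subst h; simp [Matrix.star_apply]
      · have h0 : x 0 ≠ y 0 := fun h0 => h (funext fun k => by rw [Subsingleton.elim k 0, h0])
        simp [Matrix.star_apply, h, h0]
    · intro q _ hq
      rw [Matrix.of_apply, if_neg, zero_mul]
      intro h0
      exact hq (funext fun k => by rw [Subsingleton.elim k 0, h0])
    · simp⟩

theorem flipGate_apply {W : Type} [DecidableEq W] (w : W) (b : Bool) (ψ : QState W)
    (x : W → Bool) : (flipGate w b).apply ψ x = ψ (Function.update x w (xor (x w) b)) := by
  change ∑ y : Fin 1 → Bool, (if y 0 = xor (x w) b then (1 : ℂ) else 0) *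
    ψ (Function.extend (fun _ : Fin 1 => w) y x) = _
  rw [Finset.sum_eq_single fun _ => xor (x w) b]
  · rw [if_pos rfl, one_mul]
    congr 1
    ext v
    by_cases hv : v = w
    · subst hv
      rw [Function.update_self]
      exact (Function.injective_of_subsingleton (fun _ : Fin 1 => v)).extend_apply _ _ 0
    · rw [Function.update_of_ne hv, Function.extend_apply']
      rintro ⟨_, h⟩
      exact hv h.symm
  · intro q _ hq
    rw [if_neg, zero_mul]
    intro h0
    exact hq (funext fun k => by rw [Subsingleton.elim k 0, h0])
  · simp

/-- Flipping the wires `κ s` with `z s = true`, for `s` in a list, changes a basis state on these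
wires accordingly, and nothing else. -/
theorem foldl_flipGate {S V W : Type} [DecidableEq S] [DecidableEq W] (κ : S ↪ W)
    (ι : V → W) (hικ : ∀ v s, ι v ≠ κ s) (ψ : QState V) [Fintype S] (z : S → Bool) (l : List S)
    (hl : l.Nodup) (t : S → Bool) :
    l.foldl (fun φ s => (flipGate (κ s) (z s)).apply φ)
      (fun x => ψ (fun v => x (ι v)) * if (fun s => x (κ s)) = t then 1 else 0) =
    fun x => ψ (fun v => x (ι v)) *
      if (fun s => x (κ s)) = fun s => if s ∈ l then xor (t s) (z s) else t s then 1 else 0 := by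
  induction l generalizing t with
  | nil => simp
  | cons s l ih =>
    obtain ⟨hs, hl⟩ := List.nodup_cons.1 hl
    rw [List.foldl_cons]
    have h1 : (flipGate (κ s) (z s)).apply
        (fun x => ψ (fun v => x (ι v)) * if (fun s => x (κ s)) = t then 1 else 0) =
        fun x => ψ (fun v => x (ι v)) *
          if (fun s => x (κ s)) = Function.update t s (xor (t s) (z s)) then 1 else 0 := by
      ext x
      rw [flipGate_apply]
      have h2 : (fun v => Function.update x (κ s) (xor (x (κ s)) (z s)) (ι v)) =
          fun v => x (ι v) := funext fun v => Function.update_of_ne (hικ v s) _ _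
      have h3 : (fun s' => Function.update x (κ s) (xor (x (κ s)) (z s)) (κ s')) =
          Function.update (fun s' => x (κ s')) s (xor (x (κ s)) (z s)) := by
        ext s'
        by_cases h : s' = s
        · subst h; simp
        · simp [h, κ.injective.ne h]
      rw [h2, h3]
      congr 1
      refine if_congr ?_ rfl rfl
      constructor
      · rintro rfl
        ext s'
        by_cases h : s' = s
        · subst h; simp
        · simp [h]
      · intro h
        ext s'
        have h' := congrFun h s'
        by_cases hs' : s' = s
        · subst hs'; simp at h' ⊢; rw [h']; simp
        · simpa [hs'] using h'
    rw [h1, ih hl]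
    ext x
    congr 1
    refine if_congr (Eq.congr_right ?_) rfl rfl
    ext s'
    by_cases h : s' = s
    · subst h; simp [hs]
    · simp [h]

/-- Nested runs over lists of steps, transported along `T` and flattened to a single run. -/
theorem foldl_flatMap_map {ι S S' G G' : Type*} (T : S → S') {step : ι → S → G → S}
    {step' : S' → G' → S'} {f : ι → G → G'}
    (hT : ∀ j g φ, step' (T φ) (f j g) = T (step j φ g)) (L : ι → List G) (l : List ι) (ψ : S) :
    (l.flatMap fun j => (L j).map (f j)).foldl step' (T ψ) =
      T (l.foldl (fun ψ j => (L j).foldl (step j) ψ) ψ) := by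
  have h : ∀ j (l : List G) ψ, (l.map (f j)).foldl step' (T ψ) = T (l.foldl (step j) ψ) := by
    intro j l
    induction l with
    | nil => intro ψ; rfl
    | cons g l ih => intro ψ; rw [List.map_cons, List.foldl_cons, hT, ih, List.foldl_cons]
  induction l generalizing ψ with
  | nil => rfl
  | cons j l ih => rw [List.flatMap_cons, List.foldl_append, h, ih, List.foldl_cons]

namespace Adversary

variable {n N : ℕ} (A : Adversary n N) (i : Fin N) (z : Fin N → Fin n → Bool)

/-- The wires that the reduction of an attack to the challenge of round `i` owns: those of the
adversary, and the registers of the other rounds. -/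
abbrev SpareWires : Type := Fin A.work ⊕ ({j : Fin N // j ≠ i} × Fin n)

/-- An enumeration of these wires. -/
def spareEquiv : A.SpareWires i ≃ Fin (Fintype.card (A.SpareWires i)) := Fintype.equivFin _

/-- The wires of an attack, as the wires of its reduction to the challenge of round `i`. -/
def reduceWires : A.Wires ≃ Fin (Fintype.card (A.SpareWires i)) ⊕ Fin n :=
  Equiv.trans
    { toFun := fun
        | Sum.inl a => Sum.inl (Sum.inl a)
        | Sum.inr (j, b) => if h : j = i then Sum.inr b else Sum.inl (Sum.inr (⟨j, h⟩, b))
      invFun := fun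
        | Sum.inl (Sum.inl a) => Sum.inl a
        | Sum.inl (Sum.inr (j, b)) => Sum.inr (j.1, b)
        | Sum.inr b => Sum.inr (i, b)
      left_inv := by
        rintro (a | ⟨j, b⟩)
        · rfl
        · by_cases h : j = i
          · subst h; simp
          · simp [h]
      right_inv := by
        rintro ((a | ⟨⟨j, h⟩, b⟩) | b)
        · rfl
        · simp [h]
        · simp }
    (Equiv.sumCongr (A.spareEquiv i) (Equiv.refl (Fin n)))

/-- The reduction of an attack to the challenge of round `i`: in the learning phase the adversary
also prepares the basis states `z j` in the registers of the other rounds, and she then runs all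
the rounds at once. -/
def reduce : Adversary n 1 where
  work := Fintype.card (A.SpareWires i)
  learn := A.learn.map (OracleGate.relabel
      (Function.Embedding.inl.trans (A.spareEquiv i).toEmbedding)) ++
    (Finset.univ : Finset ({j : Fin N // j ≠ i} × Fin n)).toList.map fun s =>
      .gate (flipGate (A.spareEquiv i (Sum.inr s)) (z s.1 s.2))
  answer _ := (List.finRange N).flatMap fun j => (A.answer j).map fun g =>
    g.relabel ((A.roundWires j).trans (A.reduceWires i).toEmbedding)

theorem size_reduce_le : (A.reduce i z).size ≤ 2 * A.size + 2 * (N * n) := by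
  have h1 : Fintype.card (A.SpareWires i) ≤ A.work + N * n := by
    rw [Fintype.card_sum, Fintype.card_prod, Fintype.card_fin, Fintype.card_fin]
    gcongr
    simp
  have h2 : Fintype.card ({j : Fin N // j ≠ i} × Fin n) ≤ N * n := by
    rw [Fintype.card_prod, Fintype.card_fin]
    gcongr
    simp
  have h3 : ∑ k, ((A.reduce i z).answer k).length = ∑ j, (A.answer j).length := by
    simp [reduce, List.length_flatMap, Fin.sum_univ_def]
  rw [size, h3, size]
  have h4 : (A.reduce i z).learn.length ≤ A.learn.length + N * n := by
    simpa [reduce] using h2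
  have h5 : (A.reduce i z).work ≤ A.work + N * n := h1
  omega

/-- The reduction learns the state of the original adversary next to the basis states `z`. -/
theorem learned_reduce (U : QUnitary n) : (A.reduce i z).learned U = fun x =>
    A.learned U (fun a => x (A.spareEquiv i (Sum.inl a))) *
      if (fun s : {j : Fin N // j ≠ i} × Fin n => x (A.spareEquiv i (Sum.inr s))) =
        fun s => z s.1 s.2 then 1 else 0 := by
  set f : Fin A.work ↪ Fin (Fintype.card (A.SpareWires i)) :=
    Function.Embedding.inl.trans (A.spareEquiv i).toEmbedding with hf
  set κ : {j : Fin N // j ≠ i} × Fin n ↪ Fin (Fintype.card (A.SpareWires i)) :=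
    Function.Embedding.inr.trans (A.spareEquiv i).toEmbedding with hκ
  have hfκ : ∀ v s, f v ≠ κ s := fun v s h => by
    have := (A.spareEquiv i).injective h
    cases this
  let g : QState (Fin (Fintype.card (A.SpareWires i))) := fun x =>
    if (fun s => x (κ s)) = fun _ => false then 1 else 0
  have hg : ∀ x x' : Fin (Fintype.card (A.SpareWires i)) → Bool,
      (∀ w, (∀ v, f v ≠ w) → x w = x' w) → g x = g x' := by
    intro x x' h
    have : (fun s => x (κ s)) = fun s => x' (κ s) :=
      funext fun s => h _ fun v => hfκ v s
    simp only [g, this]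
  have h0 : zeroState (Fin (Fintype.card (A.SpareWires i))) =
      fun x => zeroState (Fin A.work) (fun v => x (f v)) * g x := by
    ext x
    simp only [zeroState, g, ← ite_and, mul_ite, mul_one, mul_zero]
    refine if_congr ?_ rfl rfl
    constructor
    · rintro rfl; exact ⟨rfl, rfl⟩
    · rintro ⟨h1, h2⟩
      ext w
      obtain ⟨s, rfl⟩ := (A.spareEquiv i).surjective w
      cases s with
      | inl a => exact congrFun h2 a
      | inr s => exact congrFun h1 s
  have h1 : ∀ ψ : QState (Fin A.work), (A.learn.map (OracleGate.relabel f)).foldl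
      (fun ψ g => g.apply U ψ) (fun x => ψ (fun v => x (f v)) * g x) =
      fun x => A.learn.foldl (fun ψ g => g.apply U ψ) ψ (fun v => x (f v)) * g x := by
    induction A.learn with
    | nil => intro ψ; rfl
    | cons o l ih =>
      intro ψ
      rw [List.map_cons, List.foldl_cons, OracleGate.relabel_apply U f o ψ hg, ih]
      rfl
  have h2 : (A.learn.map (OracleGate.relabel f) ++
      (Finset.univ : Finset ({j : Fin N // j ≠ i} × Fin n)).toList.map fun s =>
        OracleGate.gate (flipGate (κ s) (z s.1 s.2))).foldl (fun ψ g => OracleGate.apply U g ψ)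
      (zeroState (Fin (Fintype.card (A.SpareWires i)))) = fun x =>
      A.learned U (fun a => x (f a)) *
        if (fun s => x (κ s)) = fun s => z s.1 s.2 then 1 else 0 := by
    rw [List.foldl_append, h0, h1, List.foldl_map]
    refine (foldl_flipGate κ f hfκ _ (fun s => z s.1 s.2) _ (Finset.nodup_toList _) _).trans ?_
    simp
    rfl
  exact h2

/-- The wires of an attack, as all the wires of its reduction. -/
def reduceAllWires : A.Wires ≃ (A.reduce i z).Wires :=
  (A.reduceWires i).trans (Equiv.sumCongr (Equiv.refl _) (Equiv.uniqueProd (Fin n) (Fin 1)).symm)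

theorem reduceAllWires_inr_self (b : Fin n) :
    A.reduceAllWires i z (Sum.inr (i, b)) = Sum.inr (0, b) := by
  simp [reduceAllWires, reduceWires]
  rfl

theorem reduceAllWires_inr_of_ne {j : Fin N} (h : j ≠ i) (b : Fin n) :
    A.reduceAllWires i z (Sum.inr (j, b)) = Sum.inl (A.spareEquiv i (Sum.inr (⟨j, h⟩, b))) := by
  simp [reduceAllWires, reduceWires, h]
  rfl

theorem initial_reduce (U : QUnitary n) (c : UnitState n) :
    (A.reduce i z).initial U (fun _ => c) = fun x =>
      A.initial U (Function.update (fun j => basisState (z j)) i c)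
        fun w => x (A.reduceAllWires i z w) := by
  ext x
  rw [initial, initial, learned_reduce, mul_assoc]
  congr 1
  rw [← Finset.mul_prod_erase _ _ (Finset.mem_univ i), Function.update_self, mul_comm]
  simp only [Finset.univ_unique, Finset.prod_singleton]
  congr 1
  · congr 1
    ext b
    exact congrArg x (A.reduceAllWires_inr_self i z b).symm
  · have h : ∀ j ∈ Finset.univ.erase i,
        (Function.update (fun j => basisState (z j)) i c j).amp
          (fun b => x (A.reduceAllWires i z (A.register j b))) =
        if (fun b => x (A.reduceAllWires i z (Sum.inr (j, b)))) = z j then 1 else 0 := by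
      intro j hj
      rw [Function.update_of_ne (Finset.ne_of_mem_erase hj), amp_basisState]
      rfl
    rw [Finset.prod_congr rfl h, Finset.prod_ite_zero]
    simp only [Finset.prod_const_one]
    refine if_congr ?_ rfl rfl
    constructor
    · intro h j hj
      ext b
      rw [A.reduceAllWires_inr_of_ne i z (Finset.ne_of_mem_erase hj)]
      exact congrFun h (⟨j, _⟩, b)
    · intro h
      ext ⟨⟨j, hj⟩, b⟩
      have := congrFun (h j (Finset.mem_erase.2 ⟨hj, Finset.mem_univ j⟩)) b
      rwa [A.reduceAllWires_inr_of_ne i z hj] at this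

theorem final_reduce (U : QUnitary n) (c : UnitState n) :
    (A.reduce i z).final U (fun _ => c) = fun x =>
      A.final U (Function.update (fun j => basisState (z j)) i c)
        fun w => x (A.reduceAllWires i z w) := by
  rw [final, initial_reduce, final]
  generalize A.initial U _ = ψ
  have hw : ∀ j, (((A.roundWires j).trans (A.reduceWires i).toEmbedding).trans
      ((A.reduce i z).roundWires 0)) =
      (A.roundWires j).trans (A.reduceAllWires i z).toEmbedding := by
    intro j
    ext w
    change (A.reduce i z).roundWires 0 (A.reduceWires i (A.roundWires j w)) =
      Equiv.sumCongr _ _ (A.reduceWires i (A.roundWires j w))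
    generalize A.reduceWires i (A.roundWires j w) = v
    cases v <;> rfl
  have hg : ∀ j (g : LocalGate (Fin A.work ⊕ Fin n)) (φ : QState A.Wires),
      ((g.relabel ((A.roundWires j).trans (A.reduceWires i).toEmbedding)).relabel
        ((A.reduce i z).roundWires 0)).apply
        (fun x => φ fun w => x (A.reduceAllWires i z w)) =
      fun x => (g.relabel (A.roundWires j)).apply φ fun w => x (A.reduceAllWires i z w) := by
    intro j g φ
    rw [← LocalGate.relabel_trans_apply, ← hw]
    rfl
  simp only [List.finRange_succ, List.finRange_zero, List.map_nil, List.foldl_cons, List.foldl_nil]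
  exact foldl_flatMap_map (fun (ψ : QState A.Wires) (x : (A.reduce i z).Wires → Bool) =>
    ψ fun w => x (A.reduceAllWires i z w))
    hg _ _ _

/-- The reduction answers its challenge as the original adversary answers the `i`-th one when all
other challenges are the basis states `z`. -/
theorem returned_reduce (U : QUnitary n) (c : UnitState n) :
    (A.reduce i z).returned U (fun _ => c) 0 =
      A.returned U (Function.update (fun j => basisState (z j)) i c) i := by
  rw [returned, returned, final_reduce, ← partialTrace_trans (A.register i) (A.reduceAllWires i z)]
  congr 1
  ext b
  exact (A.reduceAllWires_inr_self i z b).symm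

end Adversary

end

noncomputable section

open scoped ComplexOrder MatrixOrder

/-! ### Averaging over the other challenges -/

theorem applyOn_sum_smul {A W κ : Type} [Fintype A] [DecidableEq A] [Fintype κ] (e : A ↪ W)
    (V : Matrix (A → Bool) (A → Bool) ℂ) (a : κ → ℂ) (ψ : κ → QState W) :
    applyOn e V (∑ k, a k • ψ k) = ∑ k, a k • applyOn e V (ψ k) := by
  ext x
  simp only [applyOn, Finset.sum_apply, Pi.smul_apply, smul_eq_mul, Finset.mul_sum]
  rw [Finset.sum_comm]
  refine Finset.sum_congr rfl fun k _ => Finset.sum_congr rfl fun y _ => ?_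
  ring

theorem foldl_sum_smul {κ γ E : Type*} [Fintype κ] [AddCommMonoid E] [Module ℂ E]
    {step : E → γ → E}
    (h : ∀ g (a : κ → ℂ) (ψ : κ → E), step (∑ k, a k • ψ k) g = ∑ k, a k • step (ψ k) g)
    (l : List γ) (a : κ → ℂ) (ψ : κ → E) :
    l.foldl step (∑ k, a k • ψ k) = ∑ k, a k • l.foldl step (ψ k) := by
  induction l generalizing ψ with
  | nil => rfl
  | cons g l ih => simp only [List.foldl_cons, h, ih]

theorem continuous_applyOn {X A W : Type} [TopologicalSpace X] [Fintype A] [DecidableEq A]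
    (e : A ↪ W) {V : X → Matrix (A → Bool) (A → Bool) ℂ} {ψ : X → QState W} (hV : Continuous V)
    (hψ : Continuous ψ) : Continuous fun p => applyOn e (V p) (ψ p) := by
  unfold applyOn
  fun_prop

theorem continuous_foldl {X γ E : Type*} [TopologicalSpace X] [TopologicalSpace E]
    {step : X → E → γ → E}
    (h : ∀ g (ψ : X → E), Continuous ψ → Continuous fun p => step p (ψ p) g)
    (l : List γ) {ψ : X → E} (hψ : Continuous ψ) :
    Continuous fun p => l.foldl (step p) (ψ p) := by
  induction l generalizing ψ with
  | nil => exact hψ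
  | cons g l ih => exact ih (h g ψ hψ)

/-- The mean weight of the basis state `|x⟩` in a Haar-random state. -/
def meanWeight {n : ℕ} (x : Fin n → Bool) : ℝ := ∫ c : UnitState n, ‖c.amp x‖ ^ 2 ∂haarState n

theorem meanWeight_nonneg {n : ℕ} (x : Fin n → Bool) : 0 ≤ meanWeight x :=
  integral_nonneg fun _ => by positivity

theorem integral_amp_mul_star {n : ℕ} (x y : Fin n → Bool) :
    ∫ c : UnitState n, c.amp x * star (c.amp y) ∂haarState n =
      if x = y then (meanWeight x : ℂ) else 0 := by
  split_ifs with h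
  · subst h
    rw [meanWeight, ← integral_complex_ofReal]
    simp [Complex.mul_conj, Complex.normSq_eq_norm_sq]
  · exact integral_amp_mul_star_eq_zero h

theorem sum_meanWeight (n : ℕ) : ∑ x : Fin n → Bool, meanWeight x = 1 := by
  simp only [meanWeight]
  rw [← integral_finsetSum]
  · simp [sum_norm_amp_sq]
  · intro x _
    refine Integrable.of_bound (C := 1)
      ((continuous_amp x).norm.pow 2).aestronglyMeasurable (ae_of_all _ fun c => ?_)
    rw [Real.norm_of_nonneg (by positivity)]
    exact pow_le_one₀ (norm_nonneg _) (norm_amp_le_one c x)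

/-- The Haar average of a quadratic form in the amplitudes only involves its values on the basis
states, since distinct amplitudes are uncorrelated. -/
theorem integral_quadratic {n : ℕ} {f : UnitState n → ℝ}
    {G : (Fin n → Bool) → (Fin n → Bool) → ℂ}
    (hf : ∀ v, (f v : ℂ) = ∑ x, ∑ y, v.amp x * star (v.amp y) * G x y) :
    ∫ v, f v ∂haarState n = ∑ x, meanWeight x * f (basisState x) := by
  apply Complex.ofReal_injective
  rw [← integral_complex_ofReal]
  simp only [hf]
  rw [integral_finsetSum _ fun x _ => integrable_finsetSum _ fun y _ =>
    (integrable_amp_mul_star x y).mul_const _]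
  push_cast
  refine Finset.sum_congr rfl fun x _ => ?_
  rw [integral_finsetSum _ fun y _ => (integrable_amp_mul_star x y).mul_const _]
  simp only [integral_mul_const, integral_amp_mul_star, hf, amp_basisState]
  simp

namespace Adversary

variable {n N : ℕ} (A : Adversary n N)

/-- The evolution of the state during the rounds. -/
def run (ψ : QState A.Wires) : QState A.Wires :=
  (List.finRange N).foldl
    (fun ψ i => (A.answer i).foldl (fun φ g => (g.relabel (A.roundWires i)).apply φ) ψ) ψ

theorem run_sum_smul {κ : Type} [Fintype κ] (a : κ → ℂ) (ψ : κ → QState A.Wires) :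
    A.run (∑ k, a k • ψ k) = ∑ k, a k • A.run (ψ k) :=
  foldl_sum_smul (step := fun ψ i =>
    (A.answer i).foldl (fun φ g => (LocalGate.relabel (A.roundWires i) g).apply φ) ψ)
    (fun i a ψ => foldl_sum_smul (step := fun φ g => (LocalGate.relabel (A.roundWires i) g).apply φ)
      (fun _ a ψ => applyOn_sum_smul _ _ a ψ) (A.answer i) a ψ) (List.finRange N) a ψ

theorem initial_update (U : QUnitary n) (c : Fin N → UnitState n) (j : Fin N) (v : UnitState n) :
    A.initial U (Function.update c j v) =
      ∑ x, v.amp x • A.initial U (Function.update c j (basisState x)) := by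
  have h : ∀ (u : UnitState n) (s : A.Wires → Bool), A.initial U (Function.update c j u) s =
      u.amp (fun b => s (A.register j b)) * (A.learned U (fun a => s (Sum.inl a)) *
        ∏ k ∈ Finset.univ.erase j, (c k).amp fun b => s (A.register k b)) := by
    intro u s
    rw [initial, ← Finset.mul_prod_erase _ _ (Finset.mem_univ j), Function.update_self,
      mul_left_comm]
    congr 2
    exact Finset.prod_congr rfl fun k hk => by
      rw [Function.update_of_ne (Finset.ne_of_mem_erase hk)]
  ext s
  simp only [Finset.sum_apply, Pi.smul_apply, smul_eq_mul, h, amp_basisState]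
  simp

theorem final_update (U : QUnitary n) (c : Fin N → UnitState n) (j : Fin N) (v : UnitState n) :
    A.final U (Function.update c j v) =
      ∑ x, v.amp x • A.final U (Function.update c j (basisState x)) := by
  change A.run _ = ∑ x, v.amp x • A.run _
  rw [initial_update, run_sum_smul]

theorem continuous_final :
    Continuous fun p : QUnitary n × (Fin N → UnitState n) => A.final p.1 p.2 := by
  have h1 : Continuous fun p : QUnitary n × (Fin N → UnitState n) => A.learned p.1 := by
    refine continuous_foldl (step := fun (p : QUnitary n × (Fin N → UnitState n)) ψ g =>
      OracleGate.apply p.1 g ψ) ?_ A.learn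
      continuous_const
    rintro (g | e) ψ hψ
    · exact continuous_applyOn _ continuous_const hψ
    · exact continuous_applyOn _ (continuous_subtype_val.comp continuous_fst) hψ
  have h2 : Continuous fun p : QUnitary n × (Fin N → UnitState n) => A.initial p.1 p.2 := by
    refine continuous_pi fun x => ?_
    refine ((continuous_apply _).comp h1).mul (continuous_finsetProd _ fun i _ => ?_)
    exact (continuous_amp _).comp ((continuous_apply i).comp continuous_snd)
  refine continuous_foldl (step := fun _ ψ i =>
    (A.answer i).foldl (fun φ g => (g.relabel (A.roundWires i)).apply φ) ψ) ?_ _ h2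
  intro i ψ hψ
  refine continuous_foldl (step := fun _ φ g =>
    (LocalGate.relabel (A.roundWires i) g).apply φ) ?_ _ hψ
  intro g φ hφ
  exact continuous_applyOn _ continuous_const hφ

variable (i : Fin N)

/-- The squared fidelity of the `i`-th returned register with the correct response. -/
def score (U : QUnitary n) (c : Fin N → UnitState n) : ℝ :=
  fidelity (A.returned U c i) (response U (c i)) ^ 2

theorem score_nonneg (U : QUnitary n) (c : Fin N → UnitState n) : 0 ≤ A.score i U c := sq_nonneg _

theorem score_le_one (U : QUnitary n) (c : Fin N → UnitState n) : A.score i U c ≤ 1 := by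
  rw [← Complex.real_le_real, score, fidelity_returned_sq, Complex.ofReal_one,
    ← A.tensorForm_one U c]
  refine tensorForm_mono _ (fun j => ?_) fun j => ?_
  · by_cases hj : j = i
    · subst hj; simpa using posSemidef_dyad _
    · simpa [hj] using Matrix.PosSemidef.one
  · by_cases hj : j = i
    · subst hj; simpa using posSemidef_one_sub_dyad (sum_norm_response_sq U (c j))
    · simpa [hj] using Matrix.PosSemidef.zero

theorem ofReal_score (U : QUnitary n) (c : Fin N → UnitState n) :
    (A.score i U c : ℂ) = ∑ x : A.Wires → Bool, ∑ q,
      star (response U (c i) fun b => x (A.register i b)) * response U (c i) q *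
        (A.final U c x * star (A.final U c (Function.extend (A.register i) q x))) := by
  rw [score, fidelity_returned_sq, ← overlap_returned, returned,
    star_dotProduct_partialTrace_mulVec]

theorem continuous_score :
    Continuous fun p : QUnitary n × (Fin N → UnitState n) => A.score i p.1 p.2 := by
  have h : (fun p : QUnitary n × (Fin N → UnitState n) => A.score i p.1 p.2) =
      fun p => (A.score i p.1 p.2 : ℂ).re := rfl
  rw [h]
  have h1 : ∀ x, Continuous fun p : QUnitary n × (Fin N → UnitState n) => A.final p.1 p.2 x :=
    fun x => (continuous_apply x).comp A.continuous_final
  have h2 : ∀ x, Continuous fun p : QUnitary n × (Fin N → UnitState n) =>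
      response p.1 (p.2 i) x := by
    intro x
    refine continuous_finsetSum _ fun y _ => ?_
    refine Continuous.mul ?_ ?_
    · have : Continuous fun p : QUnitary n × (Fin N → UnitState n) => p.1.1 :=
        continuous_subtype_val.comp continuous_fst
      exact this.matrix_elem x y
    · exact (continuous_amp y).comp ((continuous_apply i).comp continuous_snd)
  simp only [ofReal_score]
  refine Complex.continuous_re.comp (continuous_finsetSum _ fun x _ =>
    continuous_finsetSum _ fun q _ => ?_)
  exact ((h2 _).star.mul (h2 _)).mul ((h1 _).mul (h1 _).star)

/-- The final state is linear in the challenge of any other round, so that a uniformly random such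
challenge is as good as a random basis state. -/
theorem integral_score_update {j : Fin N} (hj : j ≠ i) (U : QUnitary n)
    (c : Fin N → UnitState n) :
    ∫ v, A.score i U (Function.update c j v) ∂haarState n =
      ∑ x, meanWeight x * A.score i U (Function.update c j (basisState x)) := by
  let ψ : (Fin n → Bool) → QState A.Wires := fun x =>
    A.final U (Function.update c j (basisState x))
  let r := response U (c i)
  refine integral_quadratic (f := fun v => A.score i U (Function.update c j v))
    (G := fun x y => ∑ s : A.Wires → Bool, ∑ q, star (r fun b => s (A.register i b)) * r q *
        (ψ x s * star (ψ y (Function.extend (A.register i) q s)))) fun v => ?_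
  rw [ofReal_score, Function.update_of_ne hj.symm, final_update]
  simp only [Finset.sum_apply, Pi.smul_apply, smul_eq_mul, star_sum, Finset.sum_mul_sum]
  simp only [Finset.mul_sum]
  have h : ∀ f : (A.Wires → Bool) → (Fin n → Bool) → (Fin n → Bool) → (Fin n → Bool) → ℂ,
      ∑ s, ∑ q, ∑ x, ∑ y, f s q x y = ∑ x, ∑ y, ∑ s, ∑ q, f s q x y := by
    intro f
    simp only [← Fintype.sum_prod_type']
    exact Fintype.sum_equiv ⟨fun p => (p.2.2.1, p.2.2.2, p.1, p.2.1),
      fun p => (p.2.2.1, p.2.2.2, p.1, p.2.1), fun _ => rfl, fun _ => rfl⟩ _ _ fun _ => rfl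
  rw [h]
  refine Finset.sum_congr rfl fun x _ => Finset.sum_congr rfl fun y _ =>
    Finset.sum_congr rfl fun s _ => Finset.sum_congr rfl fun q _ => ?_
  simp only [star_mul', ψ, r]
  ring

end Adversary

end

noncomputable section

theorem integral_comp_of_measurePreserving {X Y : Type*} [MeasurableSpace X] [MeasurableSpace Y]
    {μ : Measure X} {ν : Measure Y} {f : X → Y} (hf : MeasurePreserving f μ ν) {g : Y → ℝ}
    (hg : AEStronglyMeasurable g ν) : ∫ y, g y ∂ν = ∫ x, g (f x) ∂μ := by
  rw [← hf.map_eq] at hg ⊢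
  exact integral_map hf.measurable.aemeasurable hg

theorem integrable_of_continuous_of_le_one {X : Type*} [TopologicalSpace X] [MeasurableSpace X]
    [OpensMeasurableSpace X] {f : X → ℝ} (hf : Continuous f) (h0 : ∀ x, 0 ≤ f x)
    (h1 : ∀ x, f x ≤ 1) (μ : Measure X) [IsProbabilityMeasure μ] : Integrable f μ :=
  Integrable.of_bound (C := 1) hf.aestronglyMeasurable
    (ae_of_all _ fun x => by rw [Real.norm_of_nonneg (h0 x)]; exact h1 x)

namespace Adversary

variable {n N : ℕ} (A : Adversary n N) (i : Fin N)

/-- The challenges, with those of the rounds in `s` replaced by basis states. -/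
def fixChallenges (s : Finset (Fin N)) (z : Fin N → Fin n → Bool) (c : Fin N → UnitState n) :
    Fin N → UnitState n :=
  fun j => if j ∈ s then basisState (z j) else c j

theorem fixChallenges_update {s : Finset (Fin N)} {j : Fin N} (hj : j ∉ s)
    (z : Fin N → Fin n → Bool) (c : Fin N → UnitState n) (v : UnitState n) :
    fixChallenges s z (Function.update c j v) = Function.update (fixChallenges s z c) j v := by
  ext1 k
  by_cases hk : k = j
  · subst hk; simp [fixChallenges, hj]
  · simp [fixChallenges, hk]

theorem continuous_fixChallenges (s : Finset (Fin N)) (z : Fin N → Fin n → Bool) :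
    Continuous (fixChallenges (n := n) s z) := by
  refine continuous_pi fun j => ?_
  by_cases hj : j ∈ s
  · simpa only [fixChallenges, if_pos hj] using continuous_const
  · simpa only [fixChallenges, if_neg hj] using continuous_apply j

theorem continuous_score_comp {X : Type*} [TopologicalSpace X] {φ : X → QUnitary n}
    {ψ : X → Fin N → UnitState n} (hφ : Continuous φ) (hψ : Continuous ψ) :
    Continuous fun p => A.score i (φ p) (ψ p) :=
  Continuous.comp (g := fun p : QUnitary n × (Fin N → UnitState n) => A.score i p.1 p.2)
    (f := fun x => (φ x, ψ x)) (A.continuous_score i) (hφ.prodMk hψ)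

theorem integrable_score_comp {X : Type*} [TopologicalSpace X] [MeasurableSpace X]
    [OpensMeasurableSpace X] (μ : Measure X) [IsProbabilityMeasure μ] {φ : X → QUnitary n}
    {ψ : X → Fin N → UnitState n} (hφ : Continuous φ) (hψ : Continuous ψ) :
    Integrable (fun p => A.score i (φ p) (ψ p)) μ :=
  integrable_of_continuous_of_le_one (A.continuous_score_comp i hφ hψ)
    (fun _ => A.score_nonneg i _ _) (fun _ => A.score_le_one i _ _) μ

/-- Fixing the challenge of one other round to a suitable basis state does not decrease the expected
score. -/
theorem exists_integral_score_le_insert (μ : Measure (QUnitary n)) [IsProbabilityMeasure μ]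
    {s : Finset (Fin N)} {j : Fin N} (hji : j ≠ i) (hj : j ∉ s) (z : Fin N → Fin n → Bool) :
    ∃ z' : Fin N → Fin n → Bool,
      ∫ p, A.score i p.1 (fixChallenges s z p.2) ∂(μ.prod (Measure.pi fun _ => haarState n)) ≤
      ∫ p, A.score i p.1 (fixChallenges (insert j s) z' p.2)
        ∂(μ.prod (Measure.pi fun _ => haarState n)) := by
  set π : Measure (Fin N → UnitState n) := Measure.pi fun _ => haarState n
  have hc := continuous_fixChallenges (n := n) s z
  have hint : ∀ x : Fin n → Bool, Integrable (fun p : QUnitary n × (Fin N → UnitState n) =>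
      A.score i p.1 (fixChallenges (insert j s) (Function.update z j x) p.2)) (μ.prod π) :=
    fun x => A.integrable_score_comp i _ continuous_fst
      ((continuous_fixChallenges _ _).comp continuous_snd)
  have hfix : ∀ (x : Fin n → Bool) (c : Fin N → UnitState n),
      Function.update (fixChallenges s z c) j (basisState x) =
        fixChallenges (insert j s) (Function.update z j x) c := by
    intro x c
    ext1 k
    by_cases hk : k = j
    · subst hk; simp [fixChallenges]
    · simp [fixChallenges, hk]
  have hinner : ∀ U, ∫ c, A.score i U (fixChallenges s z c) ∂π =
      ∫ c, ∑ x, meanWeight x *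
        A.score i U (fixChallenges (insert j s) (Function.update z j x) c) ∂π := by
    intro U
    have hmp : MeasurePreserving (fun p : (Fin N → UnitState n) × UnitState n =>
        Function.update p.1 j p.2) (π.prod (haarState n)) π := measurePreserving_update _ j
    have hupd : Continuous fun p : (Fin N → UnitState n) × UnitState n =>
        Function.update p.1 j p.2 := continuous_fst.update j continuous_snd
    rw [integral_comp_of_measurePreserving hmp
      (A.integrable_score_comp i _ continuous_const hc).aestronglyMeasurable, integral_prod]
    · simp only [fixChallenges_update hj, A.integral_score_update i hji, hfix]
    · exact A.integrable_score_comp i _ continuous_const (hc.comp hupd)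
  have hmean : ∫ p, A.score i p.1 (fixChallenges s z p.2) ∂(μ.prod π) =
      ∑ x, meanWeight x * ∫ p, A.score i p.1
        (fixChallenges (insert j s) (Function.update z j x) p.2) ∂(μ.prod π) := by
    rw [integral_prod (fun p : QUnitary n × (Fin N → UnitState n) =>
      A.score i p.1 (fixChallenges s z p.2))
      (A.integrable_score_comp i _ continuous_fst (hc.comp continuous_snd))]
    simp only [hinner]
    rw [← integral_prod (fun p : QUnitary n × (Fin N → UnitState n) => ∑ x, meanWeight x *
      A.score i p.1 (fixChallenges (insert j s) (Function.update z j x) p.2))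
      (integrable_finsetSum _ fun x _ => (hint x).const_mul _),
      integral_finsetSum _ fun x _ => (hint x).const_mul _]
    simp only [integral_const_mul]
  -- a weighted mean is at most the largest value
  by_contra! hlt
  set I := ∫ p, A.score i p.1 (fixChallenges s z p.2) ∂(μ.prod π)
  have hw : ∑ x : Fin n → Bool, meanWeight x * (∫ p, A.score i p.1
      (fixChallenges (insert j s) (Function.update z j x) p.2) ∂(μ.prod π) - I) = 0 := by
    simp only [mul_sub, Finset.sum_sub_distrib, ← Finset.sum_mul, sum_meanWeight, ← hmean]
    simp
  have hz := (Finset.sum_eq_zero_iff_of_nonpos fun x _ => mul_nonpos_of_nonneg_of_nonpos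
    (meanWeight_nonneg x) (sub_nonpos.2 (hlt (Function.update z j x)).le)).1 hw
  have h0 : ∀ x : Fin n → Bool, meanWeight x = 0 := fun x =>
    (mul_eq_zero.1 (hz x (Finset.mem_univ x))).resolve_right
      (sub_neg.2 (hlt (Function.update z j x))).ne
  have := sum_meanWeight n
  simp [h0] at this

/-- The expected score in round `i` is at most that of a suitable reduction to a single
challenge. -/
theorem exists_integral_score_le_reduce (μ : Measure (QUnitary n)) [IsProbabilityMeasure μ] :
    ∃ z : Fin N → Fin n → Bool,
      ∫ p, A.score i p.1 p.2 ∂(μ.prod (Measure.pi fun _ => haarState n)) ≤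
      ∫ p, (A.reduce i z).score 0 p.1 (fun _ => p.2) ∂(μ.prod (haarState n)) := by
  set π : Measure (Fin N → UnitState n) := Measure.pi fun _ => haarState n
  have h : ∀ s : Finset (Fin N), i ∉ s → ∃ z : Fin N → Fin n → Bool,
      ∫ p, A.score i p.1 p.2 ∂(μ.prod π) ≤
      ∫ p, A.score i p.1 (fixChallenges s z p.2) ∂(μ.prod π) := by
    intro s
    induction s using Finset.induction_on with
    | empty => intro _; exact ⟨fun _ _ => false, le_rfl⟩
    | insert j s hj ih =>
      intro hi
      rw [Finset.mem_insert, not_or] at hi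
      obtain ⟨z, hz⟩ := ih hi.2
      obtain ⟨z', hz'⟩ := A.exists_integral_score_le_insert i μ (Ne.symm hi.1) hj z
      exact ⟨z', hz.trans hz'⟩
  obtain ⟨z, hz⟩ := h (Finset.univ.erase i) (Finset.notMem_erase i _)
  refine ⟨z, hz.trans (le_of_eq ?_)⟩
  have hscore : ∀ U c, (A.reduce i z).score 0 U (fun _ => c) =
      A.score i U (Function.update (fun j => basisState (z j)) i c) := by
    intro U c
    simp only [score]
    rw [returned_reduce, Function.update_self]
  have hfix : ∀ c, fixChallenges (Finset.univ.erase i) z c =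
      Function.update (fun j => basisState (z j)) i (c i) := by
    intro c
    ext1 k
    by_cases hk : k = i
    · subst hk; simp [fixChallenges]
    · simp [fixChallenges, hk]
  have hupd : Continuous fun c : UnitState n =>
      Function.update (fun j => basisState (z j)) i c := continuous_const.update i continuous_id
  rw [integral_prod (fun p : QUnitary n × (Fin N → UnitState n) =>
    A.score i p.1 (fixChallenges (Finset.univ.erase i) z p.2))
    (A.integrable_score_comp i _ continuous_fst
    ((continuous_fixChallenges _ z).comp continuous_snd))]
  simp only [hfix, hscore]
  rw [integral_prod (fun p : QUnitary n × UnitState n =>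
    A.score i p.1 (Function.update (fun j => basisState (z j)) i p.2))
    (A.integrable_score_comp i _ continuous_fst (hupd.comp continuous_snd))]
  congr 1
  ext U
  have hmp : MeasurePreserving (Function.eval i) π (haarState n) :=
    measurePreserving_eval (fun _ : Fin N => haarState n) i
  rw [integral_comp_of_measurePreserving hmp
    (A.integrable_score_comp i _ continuous_const hupd).aestronglyMeasurable]

end Adversary

end

noncomputable section

/-! ### The expected probability of acceptance -/

namespace Adversary

variable {n N : ℕ} (A : Adversary n N)

theorem accept_nonneg (K M : ℕ) (μ : Measure (QUnitary n)) : 0 ≤ A.accept K M μ :=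
  integral_nonneg fun _ => integral_nonneg fun _ => mul_nonneg (by positivity)
    (Finset.sum_nonneg fun _ _ => A.acceptProb_nonneg _ _ _)

/-- The bound of `acceptProb_le` on average. The selection of the challenges does not matter for the
expected scores, because distinct members of an i.i.d. sample are i.i.d. -/
theorem accept_le {K : ℕ} (hNK : N ≤ K) (M : ℕ) (μ : Measure (QUnitary n))
    [IsProbabilityMeasure μ] : A.accept K M μ ≤ (((M : ℝ) + 1) ^ N)⁻¹ +
      ∑ i, ∫ p, A.score i p.1 p.2 ∂(μ.prod (Measure.pi fun _ => haarState n)) := by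
  set π : Measure (Fin N → UnitState n) := Measure.pi fun _ => haarState n
  set πK : Measure (Fin K → UnitState n) := Measure.pi fun _ => haarState n
  have hcard : (Fintype.card (Fin N ↪ Fin K) : ℝ) ≠ 0 := by
    have : Nonempty (Fin N ↪ Fin K) := ⟨Fin.castLEEmb hNK⟩
    exact_mod_cast Fintype.card_ne_zero
  have hint : ∀ (i : Fin N) (U : QUnitary n) (s : Fin N ↪ Fin K),
      Integrable (fun c : Fin K → UnitState n => A.score i U fun j => c (s j)) πK :=
    fun i U s => A.integrable_score_comp i _ continuous_const
      (continuous_pi fun j => continuous_apply (s j))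
  have hsel : ∀ (i : Fin N) (U : QUnitary n) (s : Fin N ↪ Fin K),
      ∫ c, A.score i U (fun j => c (s j)) ∂πK = ∫ c, A.score i U c ∂π := by
    intro i U s
    have hmp : MeasurePreserving (fun (c : Fin K → UnitState n) j => c (s j)) πK π :=
      measurePreserving_comp_embedding (haarState n) s
    exact (integral_comp_of_measurePreserving hmp (g := fun c => A.score i U c)
      (A.integrable_score_comp i _ continuous_const continuous_id).aestronglyMeasurable).symm
  have hinner : ∀ U, ∫ c, (Fintype.card (Fin N ↪ Fin K) : ℝ)⁻¹ * ∑ s : Fin N ↪ Fin K,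
      A.acceptProb M U (fun i => c (s i)) ∂πK ≤
      (((M : ℝ) + 1) ^ N)⁻¹ + ∑ i, ∫ c, A.score i U c ∂π := by
    intro U
    have hs : ∀ s : Fin N ↪ Fin K, Integrable (fun c : Fin K → UnitState n =>
        (((M : ℝ) + 1) ^ N)⁻¹ + ∑ i, A.score i U fun j => c (s j)) πK := fun s =>
      (integrable_const _).add (integrable_finsetSum _ fun i _ => hint i U s)
    have hg : Integrable (fun c : Fin K → UnitState n => (Fintype.card (Fin N ↪ Fin K) : ℝ)⁻¹ *
        ∑ s : Fin N ↪ Fin K, ((((M : ℝ) + 1) ^ N)⁻¹ + ∑ i, A.score i U fun j => c (s j))) πK :=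
      (integrable_finsetSum _ fun s _ => hs s).const_mul _
    refine (integral_mono_of_nonneg (ae_of_all _ fun c => mul_nonneg (by positivity)
      (Finset.sum_nonneg fun _ _ => A.acceptProb_nonneg _ _ _)) hg
      (ae_of_all _ fun c => mul_le_mul_of_nonneg_left
        (Finset.sum_le_sum fun s _ => A.acceptProb_le M U _) (by positivity))).trans (le_of_eq ?_)
    rw [integral_const_mul, integral_finsetSum _ fun s _ => hs s]
    have h1 : ∀ s : Fin N ↪ Fin K, ∫ c, ((((M : ℝ) + 1) ^ N)⁻¹ +
        ∑ i, A.score i U fun j => c (s j)) ∂πK =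
        (((M : ℝ) + 1) ^ N)⁻¹ + ∑ i, ∫ c, A.score i U c ∂π := by
      intro s
      rw [integral_add (integrable_const _) (integrable_finsetSum _ fun i _ => hint i U s),
        integral_finsetSum _ fun i _ => hint i U s]
      simp [hsel]
    simp only [h1, Finset.sum_const, Finset.card_univ, nsmul_eq_mul]
    rw [inv_mul_cancel_left₀ hcard]
  have hprod : ∀ i, Integrable (fun p : QUnitary n × (Fin N → UnitState n) =>
      A.score i p.1 p.2) (μ.prod π) :=
    fun i => A.integrable_score_comp i _ continuous_fst continuous_snd
  have hg : Integrable (fun U => ∑ i, ∫ c, A.score i U c ∂π) μ :=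
    integrable_finsetSum _ fun i _ => (hprod i).integral_prod_left
  have hg' : Integrable (fun U => (((M : ℝ) + 1) ^ N)⁻¹ + ∑ i, ∫ c, A.score i U c ∂π) μ :=
    (integrable_const _).add hg
  rw [accept]
  refine (integral_mono_of_nonneg (ae_of_all _ fun U => integral_nonneg fun c =>
    mul_nonneg (by positivity) (Finset.sum_nonneg fun _ _ => A.acceptProb_nonneg _ _ _))
    hg' (ae_of_all _ hinner)).trans (le_of_eq ?_)
  rw [integral_add (integrable_const _) hg,
    integral_finsetSum _ fun i _ => (hprod i).integral_prod_left]
  simp only [integral_const, probReal_univ, one_smul]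
  congr 1
  exact Finset.sum_congr rfl fun i _ => (integral_prod _ (hprod i)).symm

/-- One of the reductions to a single challenge is at least as good as the average round. -/
theorem exists_sum_score_le (μ : Measure (QUnitary n)) [IsProbabilityMeasure μ] :
    ∃ B : Adversary n 1, B.size ≤ 2 * A.size + 2 * (N * n) ∧
      ∑ i, ∫ p, A.score i p.1 p.2 ∂(μ.prod (Measure.pi fun _ => haarState n)) ≤
      N * ∫ p, B.score 0 p.1 (fun _ => p.2) ∂(μ.prod (haarState n)) := by
  rcases Nat.eq_zero_or_pos N with rfl | hN
  · -- without rounds there is nothing to reduce, and any adversary will do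
    exact ⟨⟨0, [], fun _ => []⟩, by simp [size], by simp⟩
  · have : Nonempty (Fin N) := ⟨⟨0, hN⟩⟩
    obtain ⟨i, -, hi⟩ := Finset.exists_max_image Finset.univ (fun i =>
      ∫ p, A.score i p.1 p.2 ∂(μ.prod (Measure.pi fun _ => haarState n)))
      (Finset.univ_nonempty (α := Fin N))
    obtain ⟨z, hz⟩ := A.exists_integral_score_le_reduce i μ
    refine ⟨A.reduce i z, A.size_reduce_le i z, ?_⟩
    refine (Finset.sum_le_card_nsmul _ _ _ fun j hj => (hi j hj).trans hz).trans ?_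
    simp

end Adversary

/-! ### Negligible functions -/

theorem Negligible.of_le {f g : ℕ → ℝ} (hg : Negligible g) (h0 : ∀ᶠ n in atTop, 0 ≤ f n)
    (h : ∀ᶠ n in atTop, f n ≤ g n) : Negligible f := by
  refine SuperpolynomialDecay.trans_eventually_abs_le hg ?_
  filter_upwards [h0, h] with n h0 h
  simp only [Function.comp_apply]
  rw [abs_of_nonneg h0]
  exact h.trans (le_abs_self _)

theorem Negligible.polynomial_eval_mul {f : ℕ → ℝ} (hf : Negligible f) (p : Polynomial ℕ) :
    Negligible fun n => ((p.eval n : ℕ) : ℝ) * f n := by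
  have h := SuperpolynomialDecay.polynomial_mul hf (p.map (Nat.castRingHom ℝ))
  refine h.congr fun n => ?_
  rw [Polynomial.eval_natCast_map]
  simp

theorem integral_le_add_measureReal {X : Type*} [MeasurableSpace X] (μ : Measure X)
    [IsProbabilityMeasure μ] {f : X → ℝ} (hf : Measurable f) (h0 : ∀ x, 0 ≤ f x)
    (h1 : ∀ x, f x ≤ 1) {δ : ℝ} (hδ : 0 ≤ δ) : ∫ x, f x ∂μ ≤ δ + μ.real {x | δ ≤ f x} := by
  have hs : MeasurableSet {x | δ ≤ f x} := measurableSet_le measurable_const hf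
  have hind : Integrable ({x | δ ≤ f x}.indicator fun _ => (1 : ℝ)) μ :=
    (integrable_const _).indicator hs
  have hg : Integrable (fun x => δ + {x | δ ≤ f x}.indicator (fun _ => (1 : ℝ)) x) μ :=
    (integrable_const _).add hind
  calc ∫ x, f x ∂μ ≤ ∫ x, (δ + {x | δ ≤ f x}.indicator (fun _ => (1 : ℝ)) x) ∂μ := by
        refine integral_mono_of_nonneg (ae_of_all _ h0) hg (ae_of_all _ fun x => ?_)
        beta_reduce
        by_cases hx : δ ≤ f x
        · rw [Set.indicator_of_mem (show x ∈ {x | δ ≤ f x} from hx)]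
          linarith [h1 x]
        · rw [Set.indicator_of_notMem (show x ∉ {x | δ ≤ f x} from hx)]
          linarith
    _ = δ + μ.real {x | δ ≤ f x} := by
        rw [integral_add (integrable_const _) hind, integral_indicator_const _ hs]
        simp only [integral_const, probReal_univ, smul_eq_mul, mul_one, one_mul]

/-- The expected score of an efficient adversary is negligible: it is at most an arbitrarily small
inverse polynomial plus the probability of exceeding it. -/
theorem SelectivelyUnforgeable.negligible_score {qPUF : ∀ n, Measure (QUnitary n)}
    (hprob : ∀ n, IsProbabilityMeasure (qPUF n)) (hsel : SelectivelyUnforgeable qPUF)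
    {B : ∀ n, Adversary n 1} (hB : QPT B) : Negligible fun n =>
      ∫ p, (B n).score 0 p.1 (fun _ => p.2) ∂((qPUF n).prod (haarState n)) := by
  intro k
  have hP : Tendsto (fun n : ℕ => (n : ℝ) ^ k * ((qPUF n).prod (haarState n)).real
      {p | ((n : ℝ) ^ (k + 1))⁻¹ ≤ (B n).score 0 p.1 (fun _ => p.2)}) atTop (nhds 0) :=
    hsel B hB (fun n => ((n : ℝ) ^ (k + 1))⁻¹) ⟨k + 1, Eventually.of_forall fun n => le_rfl⟩ k
  have hδ0 : Tendsto (fun n : ℕ => (n : ℝ) ^ k * ((n : ℝ) ^ (k + 1))⁻¹) atTop (nhds 0) := by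
    refine tendsto_inv_atTop_nhds_zero_nat.congr' ?_
    filter_upwards [eventually_gt_atTop 0] with n hn
    have : (n : ℝ) ≠ 0 := by exact_mod_cast hn.ne'
    rw [pow_succ]
    field_simp
  have hsum := hδ0.add hP
  rw [add_zero] at hsum
  refine squeeze_zero (fun n => ?_) (fun n => ?_) hsum
  · exact mul_nonneg (by positivity) (integral_nonneg fun _ => (B n).score_nonneg _ _ _)
  · have := hprob n
    have hcont : Continuous fun p : QUnitary n × UnitState n =>
        (B n).score 0 p.1 (fun _ => p.2) :=
      (B n).continuous_score_comp 0 (φ := Prod.fst) (ψ := fun p _ => p.2) continuous_fst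
        (continuous_pi fun _ => continuous_snd)
    have hm := hcont.measurable
    have h0 : ∀ p : QUnitary n × UnitState n, 0 ≤ (B n).score 0 p.1 (fun _ => p.2) :=
      fun p => (B n).score_nonneg 0 p.1 _
    have h1 : ∀ p : QUnitary n × UnitState n, (B n).score 0 p.1 (fun _ => p.2) ≤ 1 :=
      fun p => (B n).score_le_one 0 p.1 _
    have h2 : 0 ≤ ((n : ℝ) ^ (k + 1))⁻¹ := by positivity
    have h := integral_le_add_measureReal ((qPUF n).prod (haarState n)) hm h0 h1 h2
    exact (mul_le_mul_of_nonneg_left h (pow_nonneg n.cast_nonneg k)).trans_eq (mul_add _ _ _)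

end

theorem mainTheorem2
    (qPUF : ∀ n, Measure (QUnitary n)) (hprob : ∀ n, IsProbabilityMeasure (qPUF n))
    (hsel : SelectivelyUnforgeable qPUF)
    (K N M : ℕ → ℕ) (hK : PolyBounded K) (hNK : ∀ n, N n ≤ K n)
    (Eve : ∀ n, Adversary n (N n)) (hEve : QPT Eve) :
    (∀ (n : ℕ) (U : QUnitary n) (c : Fin (N n) → UnitState n),
      (Eve n).acceptProb (M n) U c =
        ∏ i, (1 / ((M n : ℝ) + 1) + (M n : ℝ) / ((M n : ℝ) + 1) *
          fidelity ((Eve n).tested (M n) U c i) (response U (c i)) ^ 2)) ∧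
    (∀ (n : ℕ) (U : QUnitary n) (c : Fin (N n) → UnitState n), (Eve n).IsProduct U c →
      (Eve n).acceptProb (M n) U c =
        ∏ i, (1 / ((M n : ℝ) + 1) + (M n : ℝ) / ((M n : ℝ) + 1) *
          fidelity ((Eve n).returned U c i) (response U (c i)) ^ 2)) ∧
    (∃ ν : ℕ → ℝ, Negligible ν ∧ ∀ n,
      (Eve n).accept (K n) (M n) (qPUF n) ≤ (((M n : ℝ) + 1) ^ N n)⁻¹ + ν n) ∧
    (PolyBounded (fun n => (M n + 1) ^ N n) →
      (fun n => (Eve n).accept (K n) (M n) (qPUF n))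
        =O[atTop] fun n => (((M n : ℝ) + 1) ^ N n)⁻¹) ∧
    (Negligible (fun n => (((M n : ℝ) + 1) ^ N n)⁻¹) →
      Negligible fun n => (Eve n).accept (K n) (M n) (qPUF n)) := by
  obtain ⟨pK, hpK⟩ := hK
  obtain ⟨pE, hpE⟩ := hEve
  choose B hsize hB using fun n => (Eve n).exists_sum_score_le (qPUF n)
  have hBQ : QPT B := by
    refine ⟨2 * pE + 2 * (pK * Polynomial.X), fun n => (hsize n).trans ?_⟩
    have h1 : (Eve n).size ≤ pE.eval n := hpE n
    have h2 : N n * n ≤ pK.eval n * n := Nat.mul_le_mul_right _ ((hNK n).trans (hpK n))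
    simp only [Polynomial.eval_add, Polynomial.eval_mul, Polynomial.eval_X,
      Polynomial.eval_ofNat]
    omega
  set e : ℕ → ℝ := fun n =>
    ∫ p, (B n).score 0 p.1 (fun _ => p.2) ∂((qPUF n).prod (haarState n))
  have he : Negligible e := hsel.negligible_score hprob hBQ
  have he0 : ∀ n, 0 ≤ e n := fun n => integral_nonneg fun _ => (B n).score_nonneg _ _ _
  obtain ⟨ν, hν, hν0, hle⟩ : ∃ ν : ℕ → ℝ, Negligible ν ∧ (∀ n, 0 ≤ ν n) ∧ ∀ n,
      (Eve n).accept (K n) (M n) (qPUF n) ≤ (((M n : ℝ) + 1) ^ N n)⁻¹ + ν n := by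
    refine ⟨_, he.polynomial_eval_mul pK, fun n => mul_nonneg (Nat.cast_nonneg _) (he0 n),
      fun n => ?_⟩
    refine ((Eve n).accept_le (hNK n) (M n) (qPUF n)).trans ?_
    gcongr
    refine (hB n).trans ?_
    refine mul_le_mul_of_nonneg_right ?_ (he0 n)
    exact_mod_cast (hNK n).trans (hpK n)
  refine ⟨fun n U c => (Eve n).acceptProb_eq_prod_tested (M n) U c,
    fun n U c h => (Eve n).acceptProb_eq_prod_returned (M n) U c h, ⟨ν, hν, hle⟩, ?_, ?_⟩
  · rintro ⟨p, hp⟩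
    have hsmall := (hν.polynomial_eval_mul p) 0
    simp only [pow_zero, one_mul] at hsmall
    refine IsBigO.of_bound 2 ?_
    filter_upwards [hsmall.eventually_le_const one_pos] with n hn
    have hx : 0 < ((M n : ℝ) + 1) ^ N n := by positivity
    have hxp : ((M n : ℝ) + 1) ^ N n ≤ p.eval n := by exact_mod_cast hp n
    have hνx : ν n ≤ (((M n : ℝ) + 1) ^ N n)⁻¹ := by
      rw [← one_div, le_div_iff₀ hx, mul_comm]
      exact (mul_le_mul_of_nonneg_right hxp (hν0 n)).trans hn
    rw [Real.norm_of_nonneg ((Eve n).accept_nonneg _ _ _), Real.norm_of_nonneg (by positivity)]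
    linarith [hle n]
  · intro h
    exact Negligible.of_le (SuperpolynomialDecay.add h hν)
      (Eventually.of_forall fun n => (Eve n).accept_nonneg _ _ _) (Eventually.of_forall hle)
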